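/- Let $\mathfrak g$ be a finite-dimensional simple real Lie algebra with Cartan involution $\theta$ and Cartan decomposition $\mathfrak g=\mathfrak k+\mathfrak p$, let $\mathfrak a\subseteq\mathfrak p$ be a maximal abelian subspace of $\mathfrak p$, and let $\mathfrak g_\lambda=\{x\in\mathfrak g:[h,x]=\lambda(h)x\ \text{for all } h\in\mathfrak a\}$ for $\lambda\in\mathfrak a^*$. The restricted roots are the $\lambda\neq0$ with $\mathfrak g_\lambda\ne0$. Let $\lambda_1,\dots,\lambda_r$ be a system of simple restricted roots and let $\Theta$ be a proper (possibly empty) subset of it. The level of $\lambda=\sum_i c_i\lambda_i$ is $\sum_{\lambda_i\notin\Theta}c_i$. For $k\in\mathbb Z$ let $\mathfrak g^k$ be the sum of the spaces $\mathfrak g_\lambda$ over those $\lambda$ of level $k$ which are restricted roots or zero. Put $\mathfrak n_\Theta^{+}=\bigoplus_{k>0}\mathfrak g^k$, $\mathfrak n_\Theta^-=\bigoplus_{k<0}\mathfrak g^k$, $\mathfrak l_\Theta=\mathfrak g^0$ (the Levi subalgebra) and $\mathfrak a_\Theta=\{h\in\mathfrak a:\lambda(h)=0\ \text{for all }\lambda\in\Theta\}$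 (the split part). Suppose $[\mathfrak n_\Theta^+,\mathfrak n_\Theta^-]\subseteq\mathfrak l_\Theta$. Then: 1. The level grading is a $3$-grading: $\mathfrak g=\bigoplus_{k\in\mathbb Z}\mathfrak g^k$, $[\mathfrak g^j,\mathfrak g^k]\subseteq\mathfrak g^{j+k}$ for all $j,k$, and $\mathfrak g^k\neq0$ exactly for $k\in\{-1,0,1\}$. In particular $\mathfrak n_\Theta^{\pm}=\mathfrak g^{\pm1}$ and $\mathfrak g=\mathfrak n_\Theta^+\oplus\mathfrak l_\Theta\oplus\mathfrak n_\Theta^-$. 2. $\mathfrak n_\Theta^+$ and $\mathfrak n_\Theta^-$ are abelian. 3. Exactly one simple restricted root $\lambda_e$ is not in $\Theta$. Its Coxeter label is $1$; that is, there is a unique highest restricted root (a positive restricted root $\mu$ such that $\mu+\lambda_i$ is not a restricted root for any $i$), and the coefficient of $\lambda_e$ in its expansion in the simple restricted roots is $1$. Moreover, suppose that the complexification $\mathfrak g_{\mathbb C}$ is simple. Let $\mathfrak h\supseteq\mathfrak a$ be any Cartan subalgebra of $\mathfrak g$, and choose any system of simple roots of $(\mathfrak g_{\mathbb C},\mathfrak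 h_{\mathbb C})$ that is compatible with $\lambda_1,\dots,\lambda_r$, in the sense that each simple root restricts to $\mathfrak a$ as zero or as a combination of the $\lambda_i$ with nonnegative integer coefficients. Then exactly one of these simple roots has level $1$ (the level of a root being that of its restriction to $\mathfrak a$), and its restriction to $\mathfrak a$ is $\lambda_e$. 4. $\mathfrak a_\Theta$ is one-dimensional. -/

import Mathlib

open scoped TensorProduct

namespace RestrictedRoots

section SimpleSystems

variable {V : Type*} [AddCommGroup V] [Module ℝ V] {r : ℕ}

/-- `b` enumerates a system of simple roots of the root set `R`: the `b i` are linearly independent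
elements of `R`, and each element of `R` is a combination of them whose coefficients are either all
nonnegative integers or all nonpositive integers. -/
structure IsSimpleSystem (R : Set V) (b : Fin r → V) : Prop where
  mem : ∀ i, b i ∈ R
  linearIndependent : LinearIndependent ℝ b
  pos_or_neg : ∀ v ∈ R, ∃ c : Fin r → ℕ, v = ∑ i, c i • b i ∨ v = -∑ i, c i • b i

/-- `v` is a combination of the `b i` with nonnegative integer coefficients. -/
def IsNonneg (b : Fin r → V) (v : V) : Prop :=
  ∃ c : Fin r → ℕ, v = ∑ i, c i • b i

open Classical in
/-- The integer coefficients of `v` with respect to `b`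
(zero if `v` is not an integer combination of the `b i`). -/
noncomputable def coeff (b : Fin r → V) (v : V) : Fin r → ℤ :=
  if h : ∃ c : Fin r → ℤ, v = ∑ i, c i • b i then h.choose else 0

theorem coeff_eq {b : Fin r → V} (hb : LinearIndependent ℝ b) (c : Fin r → ℤ) :
    coeff b (∑ i, c i • b i) = c := by
  have h : ∃ c' : Fin r → ℤ, ∑ i, c i • b i = ∑ i, c' i • b i := ⟨c, rfl⟩
  have hb' : LinearIndependent ℤ b :=
    hb.restrict_scalars (R := ℤ) (by
      intro x y hxy
      simpa using hxy)
  have h2 := h.choose_spec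
  rw [coeff, dif_pos h]
  funext i
  have h3 : ∑ i, (h.choose i - c i) • b i = 0 := by
    simp only [sub_smul, Finset.sum_sub_distrib]
    rw [← h2, sub_self]
  exact sub_eq_zero.mp (Fintype.linearIndependent_iff.mp hb' _ h3 i)

/-- The level of `v` relative to the set `Θ` of simple roots: the sum of the coefficients of `v`
at the simple roots outside `Θ`. -/
noncomputable def level (b : Fin r → V) (Θ : Finset (Fin r)) (v : V) : ℤ :=
  ∑ i ∈ Θᶜ, coeff b v i

/-- `v` is a highest root of `R`: a positive root to which no simple root can be added. -/
def IsHighest (R : Set V) (b : Fin r → V) (v : V) : Prop :=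
  v ∈ R ∧ IsNonneg b v ∧ ∀ i, v + b i ∉ R

end SimpleSystems

section Gradings

variable {g : Type*} [LieRing g] [LieAlgebra ℝ g]

/-- A `ℤ`-gradation of the Lie algebra `g`. -/
structure IsGradation (G : ℤ → Submodule ℝ g) : Prop where
  isInternal : DirectSum.IsInternal G
  lie_mem : ∀ j k : ℤ, ∀ x ∈ G j, ∀ y ∈ G k, ⁅x, y⁆ ∈ G (j + k)

/-- A `(2n+1)`-grading: a gradation whose nonzero subspaces are exactly the `2n+1` ones
of degrees `-n, …, n`. -/
structure IsOddGrading (n : ℕ) (G : ℤ → Submodule ℝ g) : Prop extends IsGradation G where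
  ne_bot_iff : ∀ k : ℤ, G k ≠ ⊥ ↔ |k| ≤ n

end Gradings

section Cartan

variable {g : Type*} [LieRing g] [LieAlgebra ℝ g]

/-- `θ` is a Cartan involution: an involutive automorphism for which the form
`(x, y) ↦ -κ(x, θ y)` is positive definite, `κ` being the Killing form. -/
structure IsCartanInvolution (θ : g ≃ₗ⁅ℝ⁆ g) : Prop where
  involutive : ∀ x, θ (θ x) = x
  killing_neg : ∀ x, x ≠ 0 → killingForm ℝ g x (θ x) < 0

/-- The summand `𝔭` of the Cartan decomposition `g = 𝔨 + 𝔭`: the `-1` eigenspace of `θ`. -/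
def cartanP (θ : g ≃ₗ⁅ℝ⁆ g) : Submodule ℝ g :=
  Module.End.eigenspace (θ.toLinearEquiv : g →ₗ[ℝ] g) (-1)

/-- `a` is maximal among the subspaces of `𝔭` whose elements commute. -/
def IsMaximalAbelianInP (θ : g ≃ₗ⁅ℝ⁆ g) (a : Submodule ℝ g) : Prop :=
  Maximal (fun s : Submodule ℝ g => s ≤ cartanP θ ∧ ∀ x ∈ s, ∀ y ∈ s, ⁅x, y⁆ = 0) a

variable (a : Submodule ℝ g)

/-- The restricted root space `g_μ = {x | [h, x] = μ(h) x for all h ∈ a}`; for `μ = 0` it is the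
centralizer of `a`. -/
def restrictedRootSpace (μ : Module.Dual ℝ a) : Submodule ℝ g where
  carrier := {x | ∀ h : a, ⁅(h : g), x⁆ = μ h • x}
  add_mem' := by
    intro x y hx hy h
    rw [lie_add, hx h, hy h, smul_add]
  zero_mem' := by intro h; simp
  smul_mem' := by
    intro c x hx h
    rw [lie_smul, hx h, smul_comm]

/-- The set of restricted roots (zero is not a restricted root). -/
def restrictedRoots : Set (Module.Dual ℝ a) :=
  {μ | μ ≠ 0 ∧ restrictedRootSpace a μ ≠ ⊥}

variable {r : ℕ} (b : Fin r → Module.Dual ℝ a) (Θ : Finset (Fin r))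

/-- The subspace of degree `k` of the level gradation: the sum of the spaces `g_μ` over those
`μ` of level `k` which are restricted roots or zero. -/
noncomputable def levelSpace (k : ℤ) : Submodule ℝ g :=
  ⨆ μ ∈ {μ | (μ ∈ restrictedRoots a ∨ μ = 0) ∧ level b Θ μ = k}, restrictedRootSpace a μ

/-- The sum `n_Θ^+` of the spaces of positive level. -/
noncomputable def nilPos : Submodule ℝ g := ⨆ k ∈ {k : ℤ | 0 < k}, levelSpace a b Θ k

/-- The sum `n_Θ^-` of the spaces of negative level. -/
noncomputable def nilNeg : Submodule ℝ g := ⨆ k ∈ {k : ℤ | k < 0}, levelSpace a b Θ k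

/-- The Levi subalgebra: the space of level zero. -/
noncomputable def levi : Submodule ℝ g := levelSpace a b Θ 0

/-- The split part `a_Θ`: the subspace of `a` on which all elements of `Θ` vanish. -/
def splitPart : Submodule ℝ a := ⨅ i ∈ Θ, LinearMap.ker (b i)

end Cartan

section Complexification

variable {g : Type*} [LieRing g] [LieAlgebra ℝ g]

attribute [local instance 2000] Algebra.toModule Complex.instAlgebraOfReal

variable (g) in
/-- The complexification `g_ℂ`. -/
abbrev Complexification : Type _ := ℂ ⊗[ℝ] g

/-- The real-linear maps `H → ℂ`. -/
abbrev ComplexFunctional (H : LieSubalgebra ℝ g) : Type _ := H →ₗ[ℝ] ℂ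

end Complexification

section ComplexRoots

variable {g : Type*} [LieRing g] [LieAlgebra ℝ g] (H : LieSubalgebra ℝ g)

/-- The subspace of the complexification on which each `h ∈ H` acts by the complex scalar `α(h)`. -/
def rootSpaceC (α : ComplexFunctional H) : Submodule ℂ (Complexification g) where
  carrier := {x | ∀ h : H, ⁅((1 : ℂ) ⊗ₜ[ℝ] (h : g) : Complexification g), x⁆ = α h • x}
  add_mem' := by
    intro x y hx hy h
    rw [lie_add, hx h, hy h, smul_add]
  zero_mem' := by intro h; simp
  smul_mem' := by
    intro c x hx h
    rw [lie_smul, hx h, smul_comm]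

/-- The roots of `(g_ℂ, H_ℂ)` for a Cartan subalgebra `H` of `g`, given by their values on `H`. -/
def rootsC : Set (ComplexFunctional H) :=
  {α | α ≠ 0 ∧ rootSpaceC H α ≠ ⊥}

variable {H} {a : Submodule ℝ g}

/-- The restriction of `α` to `a` is the (real-valued) functional `μ`. -/
def RestrictsTo (α : ComplexFunctional H) (μ : Module.Dual ℝ a) : Prop :=
  ∀ (x : g) (hH : x ∈ H) (ha : x ∈ a), α ⟨x, hH⟩ = ((μ ⟨x, ha⟩ : ℝ) : ℂ)

/-- The level of `α` is `k`, i.e. the restriction of `α` to `a` has level `k`. -/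
def HasLevel {r : ℕ} (b : Fin r → Module.Dual ℝ a) (Θ : Finset (Fin r))
    (α : ComplexFunctional H) (k : ℤ) : Prop :=
  ∃ μ : Module.Dual ℝ a, RestrictsTo α μ ∧ level b Θ μ = k

/-- The simple roots `β` are compatible with the simple restricted roots `b`: each `β j`, and hence
each positive root, restricts to `a` as zero or as a positive restricted root. -/
def IsCompatible {r s : ℕ} (b : Fin r → Module.Dual ℝ a) (β : Fin s → ComplexFunctional H) : Prop :=
  ∀ j, ∃ μ : Module.Dual ℝ a, RestrictsTo (β j) μ ∧ IsNonneg b μ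

end ComplexRoots

end RestrictedRoots

/-! Everything rests on the positivity of B(x, y) = -κ(x, θy), for which the adjoint of ad z is -ad
θz. Thus `a` acts by commuting symmetric operators, `g` is the direct sum of its restricted root
spaces, and θ exchanges levels k and -k.

By hypothesis [g^j, g^k] lies in g^0 when j and k have opposite signs, so it vanishes if also j + k
≠ 0. Positivity carries this over to equal signs: B([x, y], [x, y]) = -κ(x, [y, θ[x, y]]), and the
inner bracket is one of those that vanish (`lie_eq_zero_of_add_ne_zero`). Hence g^1 and g^{-1} are
abelian, and every level of absolute value at least 2 commutes with P = g^1 + g^{-1}. Each level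
lies in P or normalises it, so simplicity makes the centraliser of P zero
(`eq_zero_of_forall_lie_eq_zero`) and those levels vanish.

A highest restricted root dominates all others, because its root space generates an ideal, namely
`g`, by lowering alone (`IsHighest.isNonneg_sub`). All its coefficients are therefore at least 1,
while its level is at most 1: there is room for only one simple root outside Θ, with label 1. Since
the simple restricted roots form a basis of the dual of `a`, the dimension of the split part
follows.

Over ℂ, some root restricts to the remaining simple restricted root, which forces a simple root to
do the same. A second simple root of level 1 would, by simplicity of the complexification, yield a
root of level at least 2 in absolute value (`exists_one_lt_coeff`). -/

namespace RestrictedRoots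

/-! ### Centralisers in simple Lie algebras, regrouping of decompositions, joint eigenvectors -/

section Generalities

variable {K L : Type*} [Field K] [LieRing L] [LieAlgebra K L]

/-- In a simple Lie algebra spanned by elements which lie in `P` or normalise `P`,
the centraliser of a nonzero subspace `P` is trivial. -/
theorem eq_zero_of_forall_lie_eq_zero [LieAlgebra.IsSimple K L] {P : Submodule K L} (hP : P ≠ ⊥)
    (hspan : Submodule.span K {y : L | y ∈ P ∨ ∀ p ∈ P, ⁅y, p⁆ ∈ P} = ⊤)
    {x : L} (hx : ∀ p ∈ P, ⁅x, p⁆ = 0) : x = 0 := by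
  -- The centraliser of P is an ideal: P brackets it to zero, and normalising elements preserve it
  -- by the Jacobi identity. Were it everything, P would be central.
  let Z : LieIdeal K L :=
    { carrier := {x | ∀ p ∈ P, ⁅x, p⁆ = 0}
      add_mem' := by
        intro x y hx hy p hp
        rw [add_lie, hx p hp, hy p hp, add_zero]
      zero_mem' := by intro p _; simp
      smul_mem' := by
        intro c x hx p hp
        rw [smul_lie, hx p hp, smul_zero]
      lie_mem := by
        intro y z hz
        have hy : y ∈ Submodule.span K {y : L | y ∈ P ∨ ∀ p ∈ P, ⁅y, p⁆ ∈ P} := by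
          rw [hspan]; trivial
        revert z
        induction hy using Submodule.span_induction with
        | mem y hy =>
          intro z hz p hp
          rcases hy with hy | hy
          · rw [← lie_skew y z, hz y hy, neg_zero, zero_lie]
          · rw [lie_lie, hz p hp, hz _ (hy p hp), lie_zero, sub_zero]
        | zero => intro z _ p _; simp
        | add y y' _ _ h h' =>
          intro z hz p hp
          rw [add_lie, add_lie, h hz p hp, h' hz p hp, add_zero]
        | smul c y _ h =>
          intro z hz p hp
          rw [smul_lie, smul_lie, h hz p hp, smul_zero] }
  rcases LieAlgebra.IsSimple.eq_bot_or_eq_top (R := K) Z with h | h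
  · have : x ∈ Z := hx
    rwa [h, LieSubmodule.mem_bot] at this
  · refine absurd ?_ hP
    rw [eq_bot_iff]
    intro p hp
    have hc : p ∈ LieAlgebra.center K L := by
      rw [LieModule.mem_maxTrivSubmodule]
      intro y
      have hy : y ∈ Z := by rw [h]; trivial
      exact hy p hp
    rw [LieAlgebra.center_eq_bot, LieSubmodule.mem_bot] at hc
    exact (Submodule.mem_bot K).mpr hc

variable {M A : Type*} [AddCommGroup M] [Module K M]

theorem iSupIndep_of_degree {W : A → Submodule K M} (hW : iSupIndep W) (S : Set A) (d : A → ℤ) :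
    iSupIndep fun k : ℤ => ⨆ μ ∈ {μ | μ ∈ S ∧ d μ = k}, W μ := by
  intro k
  have h := hW.disjoint_biSup_biSup (s := {μ | μ ∈ S ∧ d μ = k}) (t := {μ | μ ∈ S ∧ d μ ≠ k}) (by
    rw [Set.disjoint_left]
    rintro μ ⟨_, h⟩ ⟨_, h'⟩
    exact h' h)
  refine h.mono_right (iSup₂_le fun j hj => iSup₂_le fun μ hμ => ?_)
  exact le_iSup₂_of_le μ ⟨hμ.1, by rw [hμ.2]; exact hj⟩ le_rfl

theorem iSup_degree_eq_top {W : A → Submodule K M} (hW : ⨆ μ, W μ = ⊤) {S : Set A}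
    (hS : ∀ μ, W μ ≠ ⊥ → μ ∈ S) (d : A → ℤ) :
    ⨆ k : ℤ, ⨆ μ ∈ {μ | μ ∈ S ∧ d μ = k}, W μ = ⊤ := by
  rw [eq_top_iff, ← hW]
  refine iSup_le fun μ => ?_
  by_cases h : W μ = ⊥
  · simp [h]
  · exact le_iSup_of_le (d μ) (le_iSup₂_of_le μ ⟨hS μ h, rfl⟩ le_rfl)

theorem lie_mem_iSup_iSup {ι κ : Type*} {U : ι → Submodule K L} {V : κ → Submodule K L}
    {N : Submodule K L} (h : ∀ i j, ∀ x ∈ U i, ∀ y ∈ V j, ⁅x, y⁆ ∈ N)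
    {x y : L} (hx : x ∈ ⨆ i, U i) (hy : y ∈ ⨆ j, V j) : ⁅x, y⁆ ∈ N := by
  induction hx using Submodule.iSup_induction' with
  | zero => simp
  | add x x' _ _ h h' => rw [add_lie]; exact N.add_mem h h'
  | mem i x hx =>
    induction hy using Submodule.iSup_induction' with
    | zero => simp
    | add x x' _ _ h h' => rw [lie_add]; exact N.add_mem h h'
    | mem j y hy => exact h i j x hx y hy

theorem lie_mem_biSup_biSup {ι κ : Type*} {s : Set ι} {t : Set κ} {U : ι → Submodule K L}
    {V : κ → Submodule K L} {N : Submodule K L}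
    (h : ∀ i ∈ s, ∀ j ∈ t, ∀ x ∈ U i, ∀ y ∈ V j, ⁅x, y⁆ ∈ N)
    {x y : L} (hx : x ∈ ⨆ i ∈ s, U i) (hy : y ∈ ⨆ j ∈ t, V j) : ⁅x, y⁆ ∈ N := by
  rw [iSup_subtype'] at hx hy
  exact lie_mem_iSup_iSup (U := fun i : s => U i) (V := fun j : t => V j)
    (fun i j x hx y hy => h i i.2 j j.2 x hx y hy) hx hy

theorem eq_zero_of_mem_of_mem {ι : Type*} {W : ι → Submodule K M} (hW : iSupIndep W) {i j : ι}
    (hij : i ≠ j) {x : M} (hi : x ∈ W i) (hj : x ∈ W j) : x = 0 :=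
  (Submodule.disjoint_def.mp (hW.pairwiseDisjoint hij)) x hi hj

/-- A nonzero subspace invariant under a commuting family contains a joint eigenvector. -/
theorem exists_joint_eigenvector [IsAlgClosed K] [FiniteDimensional K M] {ι : Type*}
    {F : ι → Module.End K M} (hF : ∀ i j, Commute (F i) (F j)) :
    ∀ (n : ℕ) (p : Submodule K M), Module.finrank K p = n → p ≠ ⊥ →
      (∀ i, ∀ v ∈ p, F i v ∈ p) → ∃ v ∈ p, v ≠ 0 ∧ ∀ i, ∃ c : K, F i v = c • v := by
  intro n
  induction n using Nat.strong_induction_on with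
  | _ n ih =>
    intro p hn hp hinv
    by_cases h : ∀ i, ∃ c : K, ∀ v ∈ p, F i v = c • v
    · obtain ⟨v, hv, hv0⟩ := Submodule.exists_mem_ne_zero_of_ne_bot hp
      exact ⟨v, hv, hv0, fun i => (h i).imp fun c hc => hc v hv⟩
    · push Not at h
      obtain ⟨i, hi⟩ := h
      have : Nontrivial p := Submodule.nontrivial_iff_ne_bot.mpr hp
      obtain ⟨c, hc⟩ := Module.End.exists_eigenvalue ((F i).restrict (hinv i))
      obtain ⟨w, hw⟩ := hc.exists_hasEigenvector
      have hw' : F i (w : M) = c • (w : M) := congrArg Subtype.val hw.apply_eq_smul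
      -- `F i` is not a scalar on p, so its eigenspace is proper and the dimension drops;
      -- commutation keeps it invariant.
      have hlt : p ⊓ Module.End.eigenspace (F i) c < p := by
        refine lt_of_le_of_ne inf_le_left fun heq => ?_
        obtain ⟨v, hv, hv'⟩ := hi c
        rw [← heq] at hv
        exact hv' (Module.End.mem_eigenspace_iff.mp hv.2)
      obtain ⟨v, hv, hv0, hv'⟩ := ih _ (hn ▸ Submodule.finrank_lt_finrank_of_lt hlt)
        (p ⊓ Module.End.eigenspace (F i) c) rfl
        ((Submodule.ne_bot_iff _).mpr ⟨w, ⟨w.2, Module.End.mem_eigenspace_iff.mpr hw'⟩, by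
          simpa using hw.2⟩)
        (by
          rintro j v ⟨hv, hv'⟩
          refine ⟨hinv j v hv, ?_⟩
          rw [SetLike.mem_coe, Module.End.mem_eigenspace_iff] at hv' ⊢
          have := congrArg (fun f : Module.End K M => f v) (hF i j).eq
          simp only [Module.End.mul_apply] at this
          rw [this, hv', map_smul])
      exact ⟨v, hv.1, hv0, hv'⟩

end Generalities

/-! ### Coefficients and levels with respect to a simple system -/

section Coefficients

variable {V : Type*} [AddCommGroup V] {r : ℕ} {R : Set V} {b : Fin r → V}

/-- `v` is a combination of the `b i` with integer coefficients. -/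
def IsIntegral (b : Fin r → V) (v : V) : Prop :=
  ∃ c : Fin r → ℤ, v = ∑ i, c i • b i

theorem IsIntegral.eq_sum {v : V} (hv : IsIntegral b v) : v = ∑ i, coeff b v i • b i := by
  have h : ∃ c : Fin r → ℤ, v = ∑ i, c i • b i := hv
  rw [coeff, dif_pos h]
  exact h.choose_spec

theorem IsIntegral.add {v w : V} (hv : IsIntegral b v) (hw : IsIntegral b w) :
    IsIntegral b (v + w) := by
  obtain ⟨c, rfl⟩ := hv
  obtain ⟨d, rfl⟩ := hw
  exact ⟨c + d, by simp [add_smul, Finset.sum_add_distrib]⟩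

theorem IsIntegral.neg {v : V} (hv : IsIntegral b v) : IsIntegral b (-v) := by
  obtain ⟨c, rfl⟩ := hv
  exact ⟨-c, by simp⟩

theorem isIntegral_zero : IsIntegral b (0 : V) := ⟨0, by simp⟩

theorem isIntegral_self (i : Fin r) : IsIntegral b (b i) :=
  ⟨Pi.single i 1, by simp [Pi.single_apply, ite_smul]⟩

theorem IsNonneg.isIntegral {v : V} (hv : IsNonneg b v) : IsIntegral b v := by
  obtain ⟨c, rfl⟩ := hv
  exact ⟨fun i => (c i : ℤ), by simp⟩

theorem eq_of_coeff_eq {v w : V} (hv : IsIntegral b v) (hw : IsIntegral b w)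
    (h : ∀ i, coeff b v i = coeff b w i) : v = w := by
  rw [hv.eq_sum, hw.eq_sum]
  simp [h]

variable [Module ℝ V]

theorem coeff_add (hb : LinearIndependent ℝ b) {v w : V} (hv : IsIntegral b v)
    (hw : IsIntegral b w) (i : Fin r) : coeff b (v + w) i = coeff b v i + coeff b w i := by
  obtain ⟨c, rfl⟩ := hv
  obtain ⟨d, rfl⟩ := hw
  have : ∑ i, c i • b i + ∑ i, d i • b i = ∑ i, (c + d) i • b i := by
    simp [add_smul, Finset.sum_add_distrib]
  rw [this, coeff_eq hb, coeff_eq hb, coeff_eq hb, Pi.add_apply]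

theorem coeff_neg (hb : LinearIndependent ℝ b) {v : V} (hv : IsIntegral b v) (i : Fin r) :
    coeff b (-v) i = -coeff b v i := by
  obtain ⟨c, rfl⟩ := hv
  have : -∑ i, c i • b i = ∑ i, (-c) i • b i := by simp
  rw [this, coeff_eq hb, coeff_eq hb, Pi.neg_apply]

theorem coeff_zero (hb : LinearIndependent ℝ b) (i : Fin r) : coeff b 0 i = 0 := by
  have : (0 : V) = ∑ i, (0 : Fin r → ℤ) i • b i := by simp
  rw [this, coeff_eq hb, Pi.zero_apply]

theorem coeff_self (hb : LinearIndependent ℝ b) (i j : Fin r) :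
    coeff b (b i) j = if j = i then 1 else 0 := by
  have : b i = ∑ j, (Pi.single i 1 : Fin r → ℤ) j • b j := by simp [Pi.single_apply, ite_smul]
  rw [this, coeff_eq hb, Pi.single_apply]

theorem isNonneg_iff (hb : LinearIndependent ℝ b) {v : V} :
    IsNonneg b v ↔ IsIntegral b v ∧ ∀ i, 0 ≤ coeff b v i := by
  constructor
  · intro h
    refine ⟨h.isIntegral, fun i => ?_⟩
    obtain ⟨c, rfl⟩ := h
    have : ∑ i, c i • b i = ∑ i, (fun i => (c i : ℤ)) i • b i := by simp
    rw [this, coeff_eq hb]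
    positivity
  · rintro ⟨h, h'⟩
    refine ⟨fun i => (coeff b v i).toNat, ?_⟩
    conv_lhs => rw [h.eq_sum]
    refine Finset.sum_congr rfl fun i _ => ?_
    rw [← natCast_zsmul, Int.toNat_of_nonneg (h' i)]

theorem IsSimpleSystem.isNonneg_or (hb : IsSimpleSystem R b) {v : V} (hv : v ∈ R ∨ v = 0) :
    IsNonneg b v ∨ IsNonneg b (-v) := by
  rcases hv with hv | rfl
  · obtain ⟨c, h | h⟩ := hb.pos_or_neg v hv
    · exact Or.inl ⟨c, h⟩
    · exact Or.inr ⟨c, by rw [h, neg_neg]⟩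
  · exact Or.inl ⟨0, by simp⟩

theorem IsSimpleSystem.isIntegral (hb : IsSimpleSystem R b) {v : V} (hv : v ∈ R ∨ v = 0) :
    IsIntegral b v := by
  rcases hb.isNonneg_or hv with h | h
  · exact h.isIntegral
  · simpa using h.isIntegral.neg

theorem IsSimpleSystem.coeff_nonneg_or (hb : IsSimpleSystem R b) {v : V} (hv : v ∈ R ∨ v = 0) :
    (∀ i, 0 ≤ coeff b v i) ∨ (∀ i, coeff b v i ≤ 0) := by
  have hi := hb.isIntegral hv
  rcases hb.isNonneg_or hv with h | h
  · exact Or.inl ((isNonneg_iff hb.linearIndependent).mp h).2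
  · refine Or.inr fun i => ?_
    have := ((isNonneg_iff hb.linearIndependent).mp h).2 i
    rw [coeff_neg hb.linearIndependent hi] at this
    linarith

theorem coeff_sum_smul (hb : LinearIndependent ℝ b) {s : ℕ} {m : Fin s → V}
    (hm : ∀ j, IsIntegral b (m j)) (c : Fin s → ℤ) (i : Fin r) :
    coeff b (∑ j, c j • m j) i = ∑ j, c j * coeff b (m j) i := by
  have : ∑ j, c j • m j = ∑ i, (fun i => ∑ j, c j * coeff b (m j) i) i • b i := by
    simp only [Finset.sum_smul, mul_smul]
    rw [Finset.sum_comm]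
    refine Finset.sum_congr rfl fun j _ => ?_
    rw [← Finset.smul_sum, ← (hm j).eq_sum]
  rw [this, coeff_eq hb]

variable (Θ : Finset (Fin r))

theorem level_sum_smul (hb : LinearIndependent ℝ b) {s : ℕ} {m : Fin s → V}
    (hm : ∀ j, IsIntegral b (m j)) (c : Fin s → ℤ) :
    level b Θ (∑ j, c j • m j) = ∑ j, c j * level b Θ (m j) := by
  simp only [level, coeff_sum_smul hb hm, Finset.mul_sum]
  exact Finset.sum_comm


theorem level_add (hb : LinearIndependent ℝ b) {v w : V} (hv : IsIntegral b v)
    (hw : IsIntegral b w) : level b Θ (v + w) = level b Θ v + level b Θ w := by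
  simp [level, coeff_add hb hv hw, Finset.sum_add_distrib]

theorem level_neg (hb : LinearIndependent ℝ b) {v : V} (hv : IsIntegral b v) :
    level b Θ (-v) = -level b Θ v := by
  simp [level, coeff_neg hb hv]

theorem level_zero (hb : LinearIndependent ℝ b) : level b Θ 0 = 0 := by
  simp [level, coeff_zero hb]

theorem level_self (hb : LinearIndependent ℝ b) (i : Fin r) :
    level b Θ (b i) = if i ∈ Θ then 0 else 1 := by
  simp only [level, coeff_self hb, Finset.sum_ite_eq', Finset.mem_compl]
  split_ifs <;> simp_all

theorem level_nonneg (hb : LinearIndependent ℝ b) {v : V} (hv : IsNonneg b v) :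
    0 ≤ level b Θ v :=
  Finset.sum_nonneg fun i _ => ((isNonneg_iff hb).mp hv).2 i

end Coefficients

/-! ### The inner product defined by the Cartan involution -/

section CartanForm

variable {g : Type*} [LieRing g] [LieAlgebra ℝ g]

/-- The form `(x, y) ↦ -κ(x, θ y)`. -/
noncomputable def cartanForm (θ : g ≃ₗ⁅ℝ⁆ g) (x y : g) : ℝ := -killingForm ℝ g x (θ y)

variable {θ : g ≃ₗ⁅ℝ⁆ g}

theorem cartanForm_add_left (x y z : g) :
    cartanForm θ (x + y) z = cartanForm θ x z + cartanForm θ y z := by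
  simp [cartanForm, add_comm]

theorem cartanForm_smul_left (c : ℝ) (x y : g) :
    cartanForm θ (c • x) y = c * cartanForm θ x y := by
  simp [cartanForm]

theorem killingForm_lie (x y z : g) :
    killingForm ℝ g ⁅x, y⁆ z = killingForm ℝ g x ⁅y, z⁆ :=
  LieModule.traceForm_apply_lie_apply ℝ g g x y z

namespace IsCartanInvolution

variable (hθ : IsCartanInvolution θ)
include hθ

theorem cartanForm_comm (x y : g) : cartanForm θ x y = cartanForm θ y x := by
  rw [cartanForm, cartanForm, ← LieAlgebra.killingForm_of_equiv_apply θ, hθ.involutive,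
    LieModule.traceForm_comm]

theorem cartanForm_pos {x : g} (hx : x ≠ 0) : 0 < cartanForm θ x x :=
  neg_pos.mpr (hθ.killing_neg x hx)

theorem cartanForm_self_nonneg (x : g) : 0 ≤ cartanForm θ x x := by
  by_cases hx : x = 0
  · simp [hx, cartanForm]
  · exact (hθ.cartanForm_pos hx).le

theorem eq_zero_of_cartanForm_self {x : g} (hx : cartanForm θ x x = 0) : x = 0 := by
  by_contra h
  exact (hθ.cartanForm_pos h).ne' hx

/-- Invariance of the Killing form, with θ moved across the bracket. -/
theorem cartanForm_lie (x y z : g) :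
    cartanForm θ ⁅z, x⁆ y = -cartanForm θ x ⁅θ z, y⁆ := by
  rw [cartanForm, cartanForm, LieEquiv.map_lie, hθ.involutive, ← killingForm_lie, ← lie_skew z x,
    map_neg, LinearMap.neg_apply]

theorem cartanForm_lie_of_map_eq_smul {z : g} {ε : ℝ} (hz : θ z = ε • z) (x y : g) :
    cartanForm θ ⁅z, x⁆ y = -ε * cartanForm θ x ⁅z, y⁆ := by
  rw [hθ.cartanForm_lie, hz, smul_lie, hθ.cartanForm_comm x, cartanForm_smul_left,
    hθ.cartanForm_comm x]
  ring

/-- A derivation which is symmetric or skew for the Cartan form has no proper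
generalised kernel. -/
theorem lie_eq_zero_of_ad_pow {z : g} {ε : ℝ} (hz : θ z = ε • z) (n : ℕ) {x : g}
    (h : ((LieAlgebra.ad ℝ g z) ^ n) x = 0) : ⁅z, x⁆ = 0 := by
  induction n generalizing x with
  | zero =>
    have : x = 0 := by simpa using h
    rw [this, lie_zero]
  | succ n ih =>
    rw [pow_succ, Module.End.mul_apply, LieAlgebra.ad_apply] at h
    have h' := ih h
    -- Moving one ad z across the form turns B([z, x], [z, x]) into a multiple of B(x, [z, [z, x]]),
    -- which vanishes by induction.
    apply hθ.eq_zero_of_cartanForm_self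
    rw [hθ.cartanForm_lie_of_map_eq_smul hz, h', hθ.cartanForm_comm]
    simp [cartanForm]

/-- The inner product space structure given by the Cartan form. -/
@[reducible]
noncomputable def innerCore : InnerProductSpace.Core ℝ g where
  inner := cartanForm θ
  conj_inner_symm x y := by simpa using hθ.cartanForm_comm y x
  re_inner_nonneg x := by simpa using hθ.cartanForm_self_nonneg x
  add_left := cartanForm_add_left
  smul_left x y c := by simpa using cartanForm_smul_left c x y
  definite x hx := hθ.eq_zero_of_cartanForm_self hx

/-- The spectral theorem for commuting symmetric operators, applied to the Cartan form. -/
theorem iSup_iInf_eigenspace_eq_top [Module.Finite ℝ g] {ι : Type*} {T : ι → g →ₗ[ℝ] g}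
    (hT : ∀ i x y, cartanForm θ (T i x) y = cartanForm θ x (T i y))
    (hc : ∀ i j, Commute (T i) (T j)) :
    ⨆ χ : ι → ℝ, ⨅ i, Module.End.eigenspace (T i) (χ i) = ⊤ := by
  let : NormedAddCommGroup g := hθ.innerCore.toNormedAddCommGroup
  let : InnerProductSpace ℝ g := InnerProductSpace.ofCore hθ.innerCore.toCore
  exact LinearMap.IsSymmetric.iSup_iInf_eq_top_of_commute (fun i x y => hT i x y)
    (fun i j _ => hc i j)

end IsCartanInvolution

end CartanForm

/-! ### Restricted root decomposition and coroots -/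

section RootSpaces

variable {g : Type*} [LieRing g] [LieAlgebra ℝ g] {a : Submodule ℝ g}

theorem lie_mem_restrictedRootSpace {μ ν : Module.Dual ℝ a} {x y : g}
    (hx : x ∈ restrictedRootSpace a μ) (hy : y ∈ restrictedRootSpace a ν) :
    ⁅x, y⁆ ∈ restrictedRootSpace a (μ + ν) := by
  intro h
  rw [leibniz_lie, hx h, hy h, smul_lie, lie_smul, LinearMap.add_apply, add_smul]

theorem mem_or_eq_zero_of_ne_bot {μ : Module.Dual ℝ a} (h : restrictedRootSpace a μ ≠ ⊥) :
    μ ∈ restrictedRoots a ∨ μ = 0 :=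
  or_iff_not_imp_right.mpr fun h0 => ⟨h0, h⟩

variable {θ : g ≃ₗ⁅ℝ⁆ g}

theorem mem_cartanP {x : g} : x ∈ cartanP θ ↔ θ x = -x := by
  rw [cartanP, Module.End.mem_eigenspace_iff]
  simp

namespace IsMaximalAbelianInP

variable (ha : IsMaximalAbelianInP θ a)
include ha

theorem map_eq_neg {h : g} (hh : h ∈ a) : θ h = -h := mem_cartanP.mp (ha.prop.1 hh)

theorem lie_eq_zero {h h' : g} (hh : h ∈ a) (hh' : h' ∈ a) : ⁅h, h'⁆ = 0 :=
  ha.prop.2 h hh h' hh'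

theorem commute_ad (h h' : a) : Commute (LieAlgebra.ad ℝ g (h : g)) (LieAlgebra.ad ℝ g (h' : g)) := by
  ext x
  simp [leibniz_lie (h : g) (h' : g) x, ha.lie_eq_zero h.2 h'.2]

theorem iSupIndep_restrictedRootSpace : iSupIndep (restrictedRootSpace a) := by
  have h1 := Module.End.independent_iInf_maxGenEigenspace_of_forall_mapsTo
    (fun h : a => LieAlgebra.ad ℝ g (h : g))
    fun h h' _ => Module.End.mapsTo_maxGenEigenspace_of_comm (ha.commute_ad h' h) _
  refine (h1.comp (f := fun μ : Module.Dual ℝ a => (μ : a → ℝ)) DFunLike.coe_injective).mono ?_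
  intro μ x hx
  simp only [Function.comp, Submodule.mem_iInf]
  intro h
  rw [Module.End.mem_maxGenEigenspace]
  exact ⟨1, by simp [hx h]⟩

theorem le_restrictedRootSpace_zero : a ≤ restrictedRootSpace a 0 := by
  intro x hx h
  simp [ha.lie_eq_zero h.2 hx]

/-- Adjoining x to `a` gives another abelian subspace of 𝔭, so maximality applies. -/
theorem mem_of_map_eq_neg {x : g} (hx : θ x = -x) (hx0 : x ∈ restrictedRootSpace a 0) : x ∈ a := by
  have h0 : ∀ h ∈ a, ⁅h, x⁆ = 0 := fun h hh => by simpa using hx0 ⟨h, hh⟩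
  have hle : a ⊔ Submodule.span ℝ {x} ≤ a := by
    refine ha.le_of_ge ⟨sup_le ha.prop.1 ?_, ?_⟩ le_sup_left
    · rw [Submodule.span_singleton_le_iff_mem]
      exact mem_cartanP.mpr hx
    · intro y hy z hz
      obtain ⟨y, hy', x', hx', rfl⟩ := Submodule.mem_sup.mp hy
      obtain ⟨c, rfl⟩ := Submodule.mem_span_singleton.mp hx'
      obtain ⟨z, hz', x', hx', rfl⟩ := Submodule.mem_sup.mp hz
      obtain ⟨d, rfl⟩ := Submodule.mem_span_singleton.mp hx'
      have h1 : ⁅x, z⁆ = 0 := by rw [← lie_skew, h0 z hz', neg_zero]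
      simp [h0 y hy', h1, ha.lie_eq_zero hy' hz']
  exact hle (Submodule.mem_sup_right (Submodule.mem_span_singleton_self x))

theorem map_mem {μ : Module.Dual ℝ a} {x : g} (hx : x ∈ restrictedRootSpace a μ) :
    θ x ∈ restrictedRootSpace a (-μ) := by
  intro h
  have := congrArg θ (hx h)
  rw [LieEquiv.map_lie, ha.map_eq_neg h.2, neg_lie, map_smul] at this
  rw [LinearMap.neg_apply, neg_smul, ← this, neg_neg]

variable (hθ : IsCartanInvolution θ)
include hθ

theorem iSup_restrictedRootSpace [Module.Finite ℝ g] : ⨆ μ, restrictedRootSpace a μ = ⊤ := by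
  rw [eq_top_iff, ← hθ.iSup_iInf_eigenspace_eq_top (ι := a)
    (T := fun h => LieAlgebra.ad ℝ g (h : g)) ?_ ?_]
  · refine iSup_le fun χ => ?_
    by_cases hχ : (⨅ h : a, Module.End.eigenspace (LieAlgebra.ad ℝ g (h : g)) (χ h)) = ⊥
    · rw [hχ]; exact bot_le
    obtain ⟨v, hv, hv0⟩ := Submodule.exists_mem_ne_zero_of_ne_bot hχ
    simp only [Submodule.mem_iInf, Module.End.mem_eigenspace_iff, LieAlgebra.ad_apply] at hv
    -- A family of joint eigenvalues with a nonzero eigenvector is automatically linear.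
    let μ : Module.Dual ℝ a :=
      { toFun := χ
        map_add' := fun h h' => by
          have := hv (h + h')
          rw [Submodule.coe_add, add_lie, hv h, hv h', ← add_smul] at this
          exact (smul_left_injective ℝ hv0 this).symm
        map_smul' := fun c h => by
          have := hv (c • h)
          rw [Submodule.coe_smul, smul_lie, hv h, smul_smul] at this
          exact (smul_left_injective ℝ hv0 this).symm }
    refine le_iSup_of_le μ fun x hx => ?_
    simp only [Submodule.mem_iInf, Module.End.mem_eigenspace_iff, LieAlgebra.ad_apply] at hx
    exact hx
  · intro h x y
    have := hθ.cartanForm_lie_of_map_eq_smul (ε := -1) (z := (h : g))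
      (by rw [ha.map_eq_neg h.2]; simp) x y
    simpa using this
  · exact ha.commute_ad

theorem lie_map_self_mem {μ : Module.Dual ℝ a} {x : g} (hx : x ∈ restrictedRootSpace a μ) :
    ⁅x, θ x⁆ ∈ a := by
  apply ha.mem_of_map_eq_neg
  · rw [LieEquiv.map_lie, hθ.involutive, lie_skew]
  · simpa using lie_mem_restrictedRootSpace hx (ha.map_mem hx)

/-- The vector t is -[x, θx] / B(x, x), which lies in `a`. When θx kills z, the adjoint rule gives 0
≤ B([x, z], [x, z]) = -B(x, x) ν(t) B(z, z), whence the sign. -/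
theorem exists_coroot {μ ν : Module.Dual ℝ a} {x z : g} (hx : x ∈ restrictedRootSpace a μ)
    (hx0 : x ≠ 0) (hz : z ∈ restrictedRootSpace a ν) (hz0 : z ≠ 0) (h : ⁅θ x, z⁆ = 0) :
    ∃ t : a, (∀ h : a, killingForm ℝ g (t : g) (h : g) = μ h) ∧ ν t ≤ 0 := by
  have hB := hθ.cartanForm_pos hx0
  have hBz := hθ.cartanForm_pos hz0
  set N := cartanForm θ x x with hN
  let t : a := (-N⁻¹) • ⟨⁅x, θ x⁆, ha.lie_map_self_mem hθ hx⟩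
  refine ⟨t, fun k => ?_, ?_⟩
  · have h1 : killingForm ℝ g ⁅x, θ x⁆ (k : g) = -N * μ k := by
      have h2 : ⁅θ x, (k : g)⁆ = μ k • θ x := by
        rw [← lie_skew, ha.map_mem hx k]
        simp
      rw [killingForm_lie, h2, map_smul, hN, cartanForm, smul_eq_mul]
      ring
    change killingForm ℝ g ((-N⁻¹) • ⁅x, θ x⁆) (k : g) = μ k
    rw [map_smul, LinearMap.smul_apply, h1, smul_eq_mul]
    field_simp
  · have h1 : ⁅⁅x, θ x⁆, z⁆ = -(N * ν t) • z := by
      have := hz t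
      change ⁅(-N⁻¹) • ⁅x, θ x⁆, z⁆ = ν t • z at this
      rw [neg_mul_eq_neg_mul, mul_smul, ← this, smul_lie, smul_smul]
      rw [neg_mul_neg, mul_inv_cancel₀ hB.ne', one_smul]
    have h2 : ⁅θ x, ⁅x, z⁆⁆ = (N * ν t) • z := by
      rw [leibniz_lie, h, lie_zero, add_zero, ← lie_skew (θ x) x, neg_lie, h1, neg_smul, neg_neg]
    have h3 := hθ.cartanForm_self_nonneg ⁅x, z⁆
    rw [hθ.cartanForm_lie, h2, hθ.cartanForm_comm, cartanForm_smul_left] at h3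
    by_contra hc
    have := mul_pos (mul_pos hB (not_le.mp hc)) hBz
    linarith

/-- A vector of nonzero nonnegative weight killed by the negative simple root spaces is zero. -/
theorem eq_zero_of_lie_map_eq_zero {r : ℕ} {b : Fin r → Module.Dual ℝ a}
    (hb : ∀ i, b i ∈ restrictedRoots a) {ν : Module.Dual ℝ a} (hν : IsNonneg b ν) (hν0 : ν ≠ 0)
    {z : g} (hz : z ∈ restrictedRootSpace a ν)
    (h : ∀ i, ∀ x ∈ restrictedRootSpace a (b i), ⁅θ x, z⁆ = 0) : z = 0 := by
  by_contra hz0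
  have : ∀ i, ∃ t : a, (∀ h : a, killingForm ℝ g (t : g) (h : g) = b i h) ∧ ν t ≤ 0 := by
    intro i
    obtain ⟨x, hx, hx0⟩ := Submodule.exists_mem_ne_zero_of_ne_bot (hb i).2
    exact ha.exists_coroot hθ hx hx0 hz hz0 (h i x hx)
  choose t ht hνt using this
  obtain ⟨c, hc⟩ := hν
  -- T represents ν through the Killing form, so B(T, T) = ν(T). This is a sum of nonpositive terms,
  -- hence T = 0 and ν = 0.
  let T : a := ∑ i, c i • t i
  have hT : ∀ h : a, killingForm ℝ g (T : g) (h : g) = ν h := by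
    intro h
    rw [hc]
    simp [T, ht]
  have h1 : ν T ≤ 0 := by
    simp only [T, map_sum, map_nsmul]
    exact Finset.sum_nonpos fun i _ => nsmul_nonpos (hνt i) _
  have h2 : cartanForm θ (T : g) T = ν T := by
    rw [cartanForm, ha.map_eq_neg T.2, map_neg, neg_neg, hT]
  have h3 : (T : g) = 0 :=
    hθ.eq_zero_of_cartanForm_self (le_antisymm (h2 ▸ h1) (hθ.cartanForm_self_nonneg _))
  apply hν0
  ext h
  rw [← hT h, h3]
  simp

end IsMaximalAbelianInP

end RootSpaces

/-! ### Generation by simple root spaces and the highest restricted root -/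

section HighestRoot

variable {g : Type*} [LieRing g] [LieAlgebra ℝ g] [Module.Finite ℝ g] {a : Submodule ℝ g}
  {θ : g ≃ₗ⁅ℝ⁆ g}

theorem IsCartanInvolution.exists_orthogonal (hθ : IsCartanInvolution θ) {U W : Submodule ℝ g}
    (h : U < W) : ∃ z ∈ W, z ≠ 0 ∧ ∀ u ∈ U, cartanForm θ u z = 0 := by
  let : NormedAddCommGroup g := hθ.innerCore.toNormedAddCommGroup
  let : InnerProductSpace ℝ g := InnerProductSpace.ofCore hθ.innerCore.toCore
  have h1 : U ⊔ Uᗮ ⊓ W = W := Submodule.sup_orthogonal_inf_of_hasOrthogonalProjection h.le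
  have h2 : Uᗮ ⊓ W ≠ ⊥ := by
    intro h2
    rw [h2, sup_bot_eq] at h1
    exact h.ne h1
  obtain ⟨z, hz, hz0⟩ := Submodule.exists_mem_ne_zero_of_ne_bot h2
  exact ⟨z, hz.2, hz0, fun u hu => (Submodule.mem_orthogonal U z).mp hz.1 u hu⟩

variable {r : ℕ} {b : Fin r → Module.Dual ℝ a} (ha : IsMaximalAbelianInP θ a)
  (hθ : IsCartanInvolution θ) (hb : IsSimpleSystem (restrictedRoots a) b)

omit [Module.Finite ℝ g] in
theorem IsSimpleSystem.restrictedRootSpace_eq_bot (hb : IsSimpleSystem (restrictedRoots a) b)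
    {ν : Module.Dual ℝ a} {i j : Fin r} (hi : 0 < coeff b ν i) (hj : coeff b ν j < 0) :
    restrictedRootSpace a ν = ⊥ := by
  by_contra h
  rcases hb.coeff_nonneg_or (mem_or_eq_zero_of_ne_bot h) with h' | h'
  · exact absurd (h' j) (by lia)
  · exact absurd (h' i) (by lia)

include ha hθ hb

/-- The restricted root spaces of positive roots lie in any subalgebra containing the
centraliser of `a` and the simple root spaces. -/
theorem restrictedRootSpace_le_of_isNonneg {S : LieSubalgebra ℝ g}
    (h0 : restrictedRootSpace a 0 ≤ S.toSubmodule)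
    (h1 : ∀ i, restrictedRootSpace a (b i) ≤ S.toSubmodule) (n : ℕ) :
    ∀ ν, IsNonneg b ν → ∑ i, coeff b ν i ≤ n → restrictedRootSpace a ν ≤ S.toSubmodule := by
  have hli := hb.linearIndependent
  induction n with
  | zero =>
    intro ν hν hn
    obtain ⟨hi, hc⟩ := (isNonneg_iff hli).mp hν
    have : ν = 0 := by
      refine eq_of_coeff_eq hi isIntegral_zero fun i => ?_
      rw [coeff_zero hli]
      exact (Finset.sum_eq_zero_iff_of_nonneg fun i _ => hc i).mp
        (le_antisymm hn (Finset.sum_nonneg fun i _ => hc i)) i (Finset.mem_univ i)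
    exact this ▸ h0
  | succ n ih =>
    intro ν hν hn
    obtain ⟨hi, hc⟩ := (isNonneg_iff hli).mp hν
    by_cases hν0 : ν = 0
    · exact hν0 ▸ h0
    by_contra hle
    have hlt : S.toSubmodule ⊓ restrictedRootSpace a ν < restrictedRootSpace a ν :=
      lt_of_le_of_ne inf_le_right fun h => hle (inf_eq_right.mp h)
    -- Take z in the root space orthogonal to S. By induction on height [x, [θx, z]] lies in S, so 0
    -- = B([x, [θx, z]], z) = -B([θx, z], [θx, z]). Thus z is killed by all negative simple root
    -- spaces and must vanish.
    obtain ⟨z, hz, hz0, hzU⟩ := hθ.exists_orthogonal hlt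
    refine hz0 (ha.eq_zero_of_lie_map_eq_zero hθ hb.mem hν hν0 hz fun i x hx => ?_)
    have hint : IsIntegral b (-b i + ν) := (isIntegral_self i).neg.add hi
    have hcoeff : ∀ j, coeff b (-b i + ν) j = coeff b ν j - if j = i then 1 else 0 := by
      intro j
      rw [coeff_add hli (isIntegral_self i).neg hi, coeff_neg hli (isIntegral_self i),
        coeff_self hli]
      ring
    have hS : restrictedRootSpace a (-b i + ν) ≤ S.toSubmodule := by
      by_cases hbot : restrictedRootSpace a (-b i + ν) = ⊥
      · rw [hbot]; exact bot_le
      -- If `b i` does not occur in ν, then ν - `b i` has coefficients of both signs and cannot be a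
      -- root, unless ν = 0.
      by_cases hci : coeff b ν i = 0
      · exfalso
        apply hν0
        refine eq_of_coeff_eq hi isIntegral_zero fun j => ?_
        rw [coeff_zero hli]
        by_cases hj : j = i
        · rw [hj, hci]
        · by_contra hj0
          refine hbot (hb.restrictedRootSpace_eq_bot (i := j) (j := i) ?_ ?_)
          · rw [hcoeff, if_neg hj]
            have := hc j
            lia
          · rw [hcoeff, if_pos rfl, hci]
            lia
      · refine ih _ ((isNonneg_iff hli).mpr ⟨hint, fun j => ?_⟩) ?_
        · rw [hcoeff]
          have := hc j
          split_ifs with h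
          · subst h
            lia
          · lia
        · simp only [hcoeff, Finset.sum_sub_distrib, Finset.sum_ite_eq', Finset.mem_univ, if_true]
          push_cast at hn
          lia
    have hy : ⁅θ x, z⁆ ∈ restrictedRootSpace a (-b i + ν) :=
      lie_mem_restrictedRootSpace (ha.map_mem hx) hz
    have h2 := hzU ⁅x, ⁅θ x, z⁆⁆ ⟨S.lie_mem (h1 i hx) (hS hy), by
      have := lie_mem_restrictedRootSpace hx hy
      rwa [add_neg_cancel_left] at this⟩
    rw [hθ.cartanForm_lie, neg_eq_zero] at h2
    exact hθ.eq_zero_of_cartanForm_self h2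

/-- Positive roots come from the preceding induction; negative ones from the same result for the
preimage of S under θ. -/
theorem lieSubalgebra_eq_top {S : LieSubalgebra ℝ g}
    (h0 : restrictedRootSpace a 0 ≤ S.toSubmodule)
    (h1 : ∀ i, restrictedRootSpace a (b i) ≤ S.toSubmodule)
    (h2 : ∀ i, restrictedRootSpace a (-b i) ≤ S.toSubmodule) : S.toSubmodule = ⊤ := by
  rw [eq_top_iff, ← ha.iSup_restrictedRootSpace hθ]
  have key : ∀ {S : LieSubalgebra ℝ g}, restrictedRootSpace a 0 ≤ S.toSubmodule →
      (∀ i, restrictedRootSpace a (b i) ≤ S.toSubmodule) →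
      ∀ ν, IsNonneg b ν → restrictedRootSpace a ν ≤ S.toSubmodule := fun h0 h1 ν hν =>
    restrictedRootSpace_le_of_isNonneg ha hθ hb h0 h1 (∑ i, coeff b ν i).toNat ν hν
      (Int.self_le_toNat _)
  refine iSup_le fun ν => ?_
  by_cases hbot : restrictedRootSpace a ν = ⊥
  · rw [hbot]; exact bot_le
  rcases hb.isNonneg_or (mem_or_eq_zero_of_ne_bot hbot) with hν | hν
  · exact key h0 h1 ν hν
  · intro x hx
    have h3 := key (S := S.comap (θ : g →ₗ⁅ℝ⁆ g)) (fun y hy => ?_) (fun i y hy => ?_) _ hν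
      (ha.map_mem hx)
    · have : θ (θ x) ∈ S := h3
      rwa [hθ.involutive] at this
    · have := ha.map_mem hy
      rw [neg_zero] at this
      exact h0 this
    · exact h2 i (ha.map_mem hy)

/-- Every restricted root is dominated by any highest one. -/
theorem IsHighest.isNonneg_sub [LieAlgebra.IsSimple ℝ g] {μ : Module.Dual ℝ a}
    (hμ : IsHighest (restrictedRoots a) b μ) {ν : Module.Dual ℝ a} (hν : ν ∈ restrictedRoots a) :
    IsNonneg b (μ - ν) := by
  have hli := hb.linearIndependent
  obtain ⟨hμR, hμn, hμh⟩ := hμ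
  let F : Set (Submodule ℝ g) := {N | restrictedRootSpace a μ ≤ N ∧
    ∀ i, ∀ y ∈ restrictedRootSpace a (-b i), ∀ v ∈ N, ⁅y, v⁆ ∈ N}
  -- I is what the negative simple root spaces generate from the highest root space. It turns out to
  -- be a nonzero ideal, hence all of `g`, although all its weights lie below μ.
  let I : Submodule ℝ g := sInf F
  have hI : ∀ N ∈ F, I ≤ N := fun N hN => sInf_le hN
  have hμI : restrictedRootSpace a μ ≤ I := le_sInf fun N hN => hN.1
  have hneg : ∀ i, ∀ y ∈ restrictedRootSpace a (-b i), ∀ v ∈ I, ⁅y, v⁆ ∈ I := by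
    intro i y hy v hv
    rw [Submodule.mem_sInf]
    exact fun N hN => hN.2 i y hy v (hI N hN hv)
  -- Minimality of I as an induction principle: Q preserves I once it sends the highest root space
  -- into I and its brackets with the negative simple root spaces preserve I.
  have hind : ∀ Q : Submodule ℝ g,
      (∀ v ∈ restrictedRootSpace a μ, ∀ y ∈ Q, ⁅y, v⁆ ∈ I) →
      (∀ i, ∀ z ∈ restrictedRootSpace a (-b i), ∀ v ∈ I, ∀ y ∈ Q, ⁅⁅y, z⁆, v⁆ ∈ I) →
      ∀ y ∈ Q, ∀ v ∈ I, ⁅y, v⁆ ∈ I := by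
    intro Q h1 h2 y hy v hv
    let N : Submodule ℝ g :=
      { carrier := {v | v ∈ I ∧ ∀ y ∈ Q, ⁅y, v⁆ ∈ I}
        add_mem' := fun h h' => ⟨I.add_mem h.1 h'.1, fun y hy => by
          rw [lie_add]; exact I.add_mem (h.2 y hy) (h'.2 y hy)⟩
        zero_mem' := ⟨I.zero_mem, fun y _ => by simp⟩
        smul_mem' := fun c v h => ⟨I.smul_mem c h.1, fun y hy => by
          rw [lie_smul]; exact I.smul_mem c (h.2 y hy)⟩ }
    have hN : N ∈ F := by
      refine ⟨fun v hv => ⟨hμI hv, h1 v hv⟩, fun i z hz v hv => ⟨hneg i z hz v hv.1, ?_⟩⟩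
      intro y hy
      rw [leibniz_lie]
      exact I.add_mem (h2 i z hz v hv.1 y hy) (hneg i z hz _ (hv.2 y hy))
    exact (hI N hN hv).2 y hy
  have hzero : ∀ y ∈ restrictedRootSpace a 0, ∀ v ∈ I, ⁅y, v⁆ ∈ I := by
    refine hind _ (fun v hv y hy => hμI ?_) fun i z hz v hv y hy => hneg i _ ?_ v hv
    · simpa using lie_mem_restrictedRootSpace hy hv
    · simpa using lie_mem_restrictedRootSpace hy hz
  have hpos : ∀ j, ∀ y ∈ restrictedRootSpace a (b j), ∀ v ∈ I, ⁅y, v⁆ ∈ I := by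
    intro j
    refine hind _ (fun v hv y hy => ?_) fun i z hz v hv y hy => ?_
    · have h1 := lie_mem_restrictedRootSpace hv hy
      have h2 : restrictedRootSpace a (μ + b j) = ⊥ := by
        by_contra h
        rcases mem_or_eq_zero_of_ne_bot h with h | h
        · exact hμh j h
        · have h3 := congrArg (fun w => coeff b w j) h
          simp only [coeff_add hli hμn.isIntegral (isIntegral_self j), coeff_self hli, if_true,
            coeff_zero hli] at h3
          have := ((isNonneg_iff hli).mp hμn).2 j
          lia
      rw [h2, Submodule.mem_bot, ← lie_skew, neg_eq_zero] at h1
      rw [h1]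
      exact I.zero_mem
    · have h1 := lie_mem_restrictedRootSpace hy hz
      by_cases hij : i = j
      · subst hij
        rw [add_neg_cancel] at h1
        exact hzero _ h1 v hv
      · have hc : ∀ k, coeff b (b j + -b i) k =
            (if k = j then 1 else 0) - (if k = i then 1 else 0) := by
          intro k
          rw [coeff_add hli (isIntegral_self j) (isIntegral_self i).neg,
            coeff_neg hli (isIntegral_self i), coeff_self hli, coeff_self hli, sub_eq_add_neg]
        rw [hb.restrictedRootSpace_eq_bot (i := j) (j := i)
          (by rw [hc, if_pos rfl, if_neg (Ne.symm hij)]; lia)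
          (by rw [hc, if_pos rfl, if_neg hij]; lia), Submodule.mem_bot] at h1
        rw [h1, zero_lie]
        exact I.zero_mem
  let S : LieSubalgebra ℝ g :=
    { carrier := {y | ∀ v ∈ I, ⁅y, v⁆ ∈ I}
      add_mem' := fun h h' v hv => by rw [add_lie]; exact I.add_mem (h v hv) (h' v hv)
      zero_mem' := fun v _ => by rw [zero_lie]; exact I.zero_mem
      smul_mem' := fun c y h v hv => by rw [smul_lie]; exact I.smul_mem c (h v hv)
      lie_mem' := fun h h' v hv => by
        rw [lie_lie]; exact I.sub_mem (h _ (h' v hv)) (h' _ (h v hv)) }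
  have hS : S.toSubmodule = ⊤ := lieSubalgebra_eq_top ha hθ hb (fun y hy => hzero y hy)
    (fun i y hy => hpos i y hy) (fun i y hy => hneg i y hy)
  let J : LieIdeal ℝ g :=
    { I with
      lie_mem := fun {y v} hv => by
        have : y ∈ S.toSubmodule := by rw [hS]; trivial
        exact this v hv }
  have hJ : J = ⊤ := by
    refine (LieAlgebra.IsSimple.eq_bot_or_eq_top (R := ℝ) J).resolve_left fun h => ?_
    obtain ⟨x, hx, hx0⟩ := Submodule.exists_mem_ne_zero_of_ne_bot hμR.2
    have : x ∈ J := hμI hx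
    rw [h, LieSubmodule.mem_bot] at this
    exact hx0 this
  have hmem : ∀ x, x ∈ I := fun x => by
    have : x ∈ J := by rw [hJ]; trivial
    exact this
  -- The sum of the spaces of weight at most μ has the two properties defining I, so it contains I.
  have hle : I ≤ ⨆ ν ∈ {ν | IsNonneg b (μ - ν)}, restrictedRootSpace a ν := by
    refine hI _ ⟨le_iSup₂_of_le μ (by simpa using ⟨0, by simp⟩) le_rfl, fun i y hy v hv => ?_⟩
    rw [iSup_subtype'] at hv
    induction hv using Submodule.iSup_induction' with
    | zero => simp
    | add x x' _ _ h h' => rw [lie_add]; exact Submodule.add_mem _ h h'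
    | mem ν v hv =>
      refine Submodule.mem_iSup_of_mem (-b i + ν) (Submodule.mem_iSup_of_mem ?_
        (lie_mem_restrictedRootSpace hy hv))
      obtain ⟨c, hc⟩ := ν.2
      refine ⟨c + Pi.single i 1, ?_⟩
      have : μ - (-b i + ν) = (μ - ν) + b i := by abel
      rw [this, hc]
      simp [add_smul, Finset.sum_add_distrib, Pi.single_apply, ite_smul]
  by_contra hνn
  apply hν.2
  rw [eq_bot_iff]
  intro x hx
  have := ha.iSupIndep_restrictedRootSpace.disjoint_biSup (x := ν)
    (y := {ν | IsNonneg b (μ - ν)}) hνn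
  exact (Submodule.mem_bot ℝ).mpr ((Submodule.disjoint_def.mp this) x hx (hle (hmem x)))

omit hθ in
-- A positive root of maximal height works. The roots are finite in number because their spaces are
-- independent; the index i only guarantees that there is a positive root.
theorem exists_isHighest (i : Fin r) : ∃ μ, IsHighest (restrictedRoots a) b μ := by
  have hli := hb.linearIndependent
  have hfin : {μ | μ ∈ restrictedRoots a ∧ IsNonneg b μ}.Finite :=
    (WellFoundedGT.finite_ne_bot_of_iSupIndep ha.iSupIndep_restrictedRootSpace).subset
      fun μ hμ => hμ.1.2
  have hbi : IsNonneg b (b i) := ⟨Pi.single i 1, by simp [Pi.single_apply, ite_smul]⟩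
  obtain ⟨μ, ⟨hμ, hμn⟩, hmax⟩ := Set.exists_max_image _ (fun μ => ∑ i, coeff b μ i) hfin
    ⟨b i, hb.mem i, hbi⟩
  refine ⟨μ, hμ, hμn, fun j hj => ?_⟩
  have hbj : IsNonneg b (b j) := ⟨Pi.single j 1, by simp [Pi.single_apply, ite_smul]⟩
  obtain ⟨c, hc⟩ := hμn
  obtain ⟨d, hd⟩ := hbj
  have h1 := hmax (μ + b j) ⟨hj, c + d, by
    rw [hd, hc]; simp [add_smul, Finset.sum_add_distrib]⟩
  simp only [coeff_add hli (IsNonneg.isIntegral ⟨c, hc⟩) (isIntegral_self j),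
    Finset.sum_add_distrib, coeff_self hli, Finset.sum_ite_eq', Finset.mem_univ, if_true] at h1
  lia

theorem IsHighest.unique [LieAlgebra.IsSimple ℝ g] {μ μ' : Module.Dual ℝ a}
    (hμ : IsHighest (restrictedRoots a) b μ) (hμ' : IsHighest (restrictedRoots a) b μ') :
    μ = μ' := by
  have hli := hb.linearIndependent
  have hi := hb.isIntegral (Or.inl hμ.1)
  have hi' := hb.isIntegral (Or.inl hμ'.1)
  refine eq_of_coeff_eq hi hi' fun i => ?_
  have h1 := ((isNonneg_iff hli).mp (hμ.isNonneg_sub ha hθ hb hμ'.1)).2 i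
  have h2 := ((isNonneg_iff hli).mp (hμ'.isNonneg_sub ha hθ hb hμ.1)).2 i
  rw [sub_eq_add_neg, coeff_add hli (by assumption) (IsIntegral.neg (by assumption)),
    coeff_neg hli (by assumption)] at h1 h2
  lia

theorem IsHighest.one_le_coeff [LieAlgebra.IsSimple ℝ g] {μ : Module.Dual ℝ a}
    (hμ : IsHighest (restrictedRoots a) b μ) (i : Fin r) : 1 ≤ coeff b μ i := by
  have hli := hb.linearIndependent
  have h1 := ((isNonneg_iff hli).mp (hμ.isNonneg_sub ha hθ hb (hb.mem i))).2 i
  rw [sub_eq_add_neg, coeff_add hli (hb.isIntegral (Or.inl hμ.1)) (isIntegral_self i).neg,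
    coeff_neg hli (isIntegral_self i), coeff_self hli, if_pos rfl] at h1
  lia

end HighestRoot

/-! ### The level grading and its collapse to three terms -/

section LevelGrading

variable {g : Type*} [LieRing g] [LieAlgebra ℝ g] {a : Submodule ℝ g}
  {θ : g ≃ₗ⁅ℝ⁆ g} {r : ℕ} {b : Fin r → Module.Dual ℝ a} (Θ : Finset (Fin r))

theorem restrictedRootSpace_le_levelSpace (μ : Module.Dual ℝ a) :
    restrictedRootSpace a μ ≤ levelSpace a b Θ (level b Θ μ) := by
  by_cases h : restrictedRootSpace a μ = ⊥
  · rw [h]; exact bot_le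
  · exact le_iSup₂_of_le μ ⟨mem_or_eq_zero_of_ne_bot h, rfl⟩ le_rfl

theorem iSupIndep_levelSpace (ha : IsMaximalAbelianInP θ a) : iSupIndep (levelSpace a b Θ) :=
  iSupIndep_of_degree ha.iSupIndep_restrictedRootSpace
    {μ | μ ∈ restrictedRoots a ∨ μ = 0} (level b Θ)

theorem iSup_levelSpace [Module.Finite ℝ g] (ha : IsMaximalAbelianInP θ a)
    (hθ : IsCartanInvolution θ) : ⨆ k, levelSpace a b Θ k = ⊤ :=
  iSup_degree_eq_top (ha.iSup_restrictedRootSpace hθ)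
    (S := {μ | μ ∈ restrictedRoots a ∨ μ = 0}) (fun _ => mem_or_eq_zero_of_ne_bot) (level b Θ)

theorem lie_mem_levelSpace (hb : IsSimpleSystem (restrictedRoots a) b) {j k : ℤ} {x y : g}
    (hx : x ∈ levelSpace a b Θ j) (hy : y ∈ levelSpace a b Θ k) :
    ⁅x, y⁆ ∈ levelSpace a b Θ (j + k) := by
  refine lie_mem_biSup_biSup (fun μ hμ ν hν x hx' y hy' => ?_) hx hy
  obtain ⟨hμ, rfl⟩ := hμ
  obtain ⟨hν, rfl⟩ := hν
  rw [← level_add Θ hb.linearIndependent (hb.isIntegral hμ) (hb.isIntegral hν)]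
  exact restrictedRootSpace_le_levelSpace Θ _ (lie_mem_restrictedRootSpace hx' hy')

theorem map_mem_levelSpace (ha : IsMaximalAbelianInP θ a)
    (hb : IsSimpleSystem (restrictedRoots a) b) {k : ℤ} {x : g}
    (hx : x ∈ levelSpace a b Θ k) : θ x ∈ levelSpace a b Θ (-k) := by
  have : levelSpace a b Θ k ≤ (levelSpace a b Θ (-k)).comap (θ.toLinearEquiv : g →ₗ[ℝ] g) := by
    refine iSup₂_le fun μ hμ x hx' => ?_
    obtain ⟨hμ, rfl⟩ := hμ
    rw [← level_neg Θ hb.linearIndependent (hb.isIntegral hμ)]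
    exact restrictedRootSpace_le_levelSpace Θ _ (ha.map_mem hx')
  exact this hx

theorem levelSpace_le_nilPos {k : ℤ} (hk : 0 < k) : levelSpace a b Θ k ≤ nilPos a b Θ :=
  le_iSup₂_of_le k hk le_rfl

theorem levelSpace_le_nilNeg {k : ℤ} (hk : k < 0) : levelSpace a b Θ k ≤ nilNeg a b Θ :=
  le_iSup₂_of_le k hk le_rfl

variable {Θ} (ha : IsMaximalAbelianInP θ a)
  (hθ : IsCartanInvolution θ) (hb : IsSimpleSystem (restrictedRoots a) b)
  (hcomm : ∀ x ∈ nilPos a b Θ, ∀ y ∈ nilNeg a b Θ, ⁅x, y⁆ ∈ levi a b Θ)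
include ha hb hcomm

/-- The bracket has level j + k by the grading and level 0 by hypothesis. -/
theorem lie_eq_zero_of_pos_of_neg {j k : ℤ} (hj : 0 < j) (hk : k < 0) (hjk : j + k ≠ 0) {x y : g}
    (hx : x ∈ levelSpace a b Θ j) (hy : y ∈ levelSpace a b Θ k) : ⁅x, y⁆ = 0 :=
  eq_zero_of_mem_of_mem (iSupIndep_levelSpace Θ ha) hjk (lie_mem_levelSpace Θ hb hx hy)
    (hcomm x (levelSpace_le_nilPos Θ hj hx) y (levelSpace_le_nilNeg Θ hk hy))

include hθ

theorem lie_eq_zero_of_add_ne_zero {j k : ℤ} (hj : j ≠ 0) (hk : k ≠ 0) (hjk : j + k ≠ 0) {x y : g}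
    (hx : x ∈ levelSpace a b Θ j) (hy : y ∈ levelSpace a b Θ k) : ⁅x, y⁆ = 0 := by
  have opp : ∀ {j k : ℤ}, j * k < 0 → j + k ≠ 0 → ∀ {x y : g}, x ∈ levelSpace a b Θ j →
      y ∈ levelSpace a b Θ k → ⁅x, y⁆ = 0 := by
    intro j k h hjk x y hx hy
    rcases mul_neg_iff.mp h with ⟨hj, hk⟩ | ⟨hj, hk⟩
    · exact lie_eq_zero_of_pos_of_neg ha hb hcomm hj hk hjk hx hy
    · rw [← lie_skew, lie_eq_zero_of_pos_of_neg ha hb hcomm hk hj (by lia) hy hx, neg_zero]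
  rcases lt_trichotomy (j * k) 0 with h | h | h
  · exact opp h hjk hx hy
  · exact absurd (mul_eq_zero.mp h) (by tauto)
  · apply hθ.eq_zero_of_cartanForm_self
    -- The levels k and -(j + k) have opposite signs, and their sum -j is nonzero.
    have h1 : ⁅y, θ ⁅x, y⁆⁆ = 0 := by
      refine opp (j := k) (k := -(j + k)) ?_ (by lia) hy
        (map_mem_levelSpace Θ ha hb (lie_mem_levelSpace Θ hb hx hy))
      nlinarith [mul_self_nonneg k]
    rw [cartanForm, killingForm_lie, h1, map_zero, neg_zero]

variable [Module.Finite ℝ g] [LieAlgebra.IsSimple ℝ g] (hΘ : Θ ≠ Finset.univ)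
include hΘ

omit hθ hcomm [Module.Finite ℝ g] [LieAlgebra.IsSimple ℝ g] in
theorem levelSpace_ne_bot {k : ℤ} (hk : |k| ≤ 1) : levelSpace a b Θ k ≠ ⊥ := by
  obtain ⟨e, he⟩ : ∃ e, e ∉ Θ := by
    by_contra h
    push Not at h
    exact hΘ (Finset.eq_univ_iff_forall.mpr h)
  have hW : ∀ {μ : Module.Dual ℝ a}, restrictedRootSpace a μ ≠ ⊥ →
      levelSpace a b Θ (level b Θ μ) ≠ ⊥ := fun h h' =>
    h (le_bot_iff.mp (h' ▸ restrictedRootSpace_le_levelSpace Θ _))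
  obtain ⟨x, hx, hx0⟩ := Submodule.exists_mem_ne_zero_of_ne_bot (hb.mem e).2
  have h1 : level b Θ (b e) = 1 := by rw [level_self Θ hb.linearIndependent, if_neg he]
  have hk' : k = -1 ∨ k = 0 ∨ k = 1 := by
    rw [abs_le] at hk
    lia
  rcases hk' with rfl | rfl | rfl
  · rw [← h1, ← level_neg Θ hb.linearIndependent (isIntegral_self e)]
    refine hW ((Submodule.ne_bot_iff _).mpr ⟨θ x, ha.map_mem hx, ?_⟩)
    exact fun h => hx0 (θ.injective (h.trans (map_zero θ).symm))
  -- Degree zero contains `a`, which is nonzero because it carries the nonzero functional `b e`.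
  · rw [← level_zero Θ hb.linearIndependent]
    refine hW fun h => (hb.mem e).1 ?_
    ext t
    have : (t : g) ∈ restrictedRootSpace a 0 := ha.le_restrictedRootSpace_zero t.2
    rw [h, Submodule.mem_bot, Submodule.coe_eq_zero] at this
    rw [this, map_zero, map_zero]
  · rw [← h1]
    exact hW (hb.mem e).2

/-- Such a level centralises g^1 + g^{-1}. That sum is normalised by g^0 and killed by all levels
beyond ±1, so its centraliser is trivial. -/
theorem levelSpace_eq_bot {k : ℤ} (hk : ¬|k| ≤ 1) : levelSpace a b Θ k = ⊥ := by
  have hk' : k < -1 ∨ 1 < k := by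
    rw [abs_le] at hk
    lia
  rw [eq_bot_iff]
  intro x hx
  rw [Submodule.mem_bot]
  refine eq_zero_of_forall_lie_eq_zero (K := ℝ)
    (P := levelSpace a b Θ 1 ⊔ levelSpace a b Θ (-1)) (fun h => ?_) ?_ fun p hp => ?_
  · exact levelSpace_ne_bot ha hb hΘ (k := 1) (by simp) (sup_eq_bot_iff.mp h).1
  · rw [eq_top_iff, ← iSup_levelSpace Θ (b := b) ha hθ]
    refine iSup_le fun j y hy => Submodule.subset_span ?_
    by_cases h1 : j = 1
    · subst h1
      exact Or.inl (Submodule.mem_sup_left hy)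
    by_cases h2 : j = -1
    · subst h2
      exact Or.inl (Submodule.mem_sup_right hy)
    refine Or.inr fun p hp => ?_
    obtain ⟨p, hp', q, hq, rfl⟩ := Submodule.mem_sup.mp hp
    by_cases h0 : j = 0
    · subst h0
      rw [lie_add]
      refine Submodule.add_mem_sup ?_ ?_
      · simpa using lie_mem_levelSpace Θ hb hy hp'
      · simpa using lie_mem_levelSpace Θ hb hy hq
    · rw [lie_add, lie_eq_zero_of_add_ne_zero ha hθ hb hcomm h0 one_ne_zero (by lia) hy hp',
        lie_eq_zero_of_add_ne_zero ha hθ hb hcomm h0 (by lia) (by lia) hy hq, add_zero]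
      exact Submodule.zero_mem _
  · obtain ⟨p, hp', q, hq, rfl⟩ := Submodule.mem_sup.mp hp
    rw [lie_add, lie_eq_zero_of_add_ne_zero ha hθ hb hcomm (by lia) one_ne_zero (by lia) hx hp',
      lie_eq_zero_of_add_ne_zero ha hθ hb hcomm (by lia) (by lia) (by lia) hx hq, add_zero]

theorem isOddGrading_levelSpace : IsOddGrading 1 (levelSpace a b Θ) where
  isInternal := (DirectSum.isInternal_submodule_iff_iSupIndep_and_iSup_eq_top _).mpr
    ⟨iSupIndep_levelSpace Θ ha, iSup_levelSpace Θ ha hθ⟩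
  lie_mem _ _ _ hx _ hy := lie_mem_levelSpace Θ hb hx hy
  ne_bot_iff _ := ⟨fun h => by
    by_contra h'
    exact h (levelSpace_eq_bot ha hθ hb hcomm hΘ h'), levelSpace_ne_bot ha hb hΘ⟩

theorem nilPos_eq : nilPos a b Θ = levelSpace a b Θ 1 := by
  refine le_antisymm (iSup₂_le fun k hk => ?_) (levelSpace_le_nilPos Θ one_pos)
  rcases eq_or_ne k 1 with rfl | h
  · exact le_rfl
  · rw [levelSpace_eq_bot ha hθ hb hcomm hΘ]
    · exact bot_le
    · have : 0 < k := hk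
      rw [abs_le]
      lia

theorem nilNeg_eq : nilNeg a b Θ = levelSpace a b Θ (-1) := by
  refine le_antisymm (iSup₂_le fun k hk => ?_) (levelSpace_le_nilNeg Θ (by lia))
  rcases eq_or_ne k (-1) with rfl | h
  · exact le_rfl
  · rw [levelSpace_eq_bot ha hθ hb hcomm hΘ]
    · exact bot_le
    · have : k < 0 := hk
      rw [abs_le]
      lia

theorem abs_level_le {μ : Module.Dual ℝ a} (hμ : μ ∈ restrictedRoots a ∨ μ = 0) :
    |level b Θ μ| ≤ 1 := by
  rcases hμ with hμ | rfl
  · by_contra h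
    exact hμ.2 (le_bot_iff.mp (levelSpace_eq_bot ha hθ hb hcomm hΘ h ▸
      restrictedRootSpace_le_levelSpace Θ μ))
  · simp [level_zero Θ hb.linearIndependent]

/-- The coefficients of a highest root outside Θ are each at least 1 and add up to at most 1. -/
theorem exists_unique_notMem : ∃ e : Fin r, (∀ i, i ∉ Θ ↔ i = e) ∧
    ∀ μ, IsHighest (restrictedRoots a) b μ → coeff b μ e = 1 := by
  obtain ⟨e, he⟩ : ∃ e, e ∉ Θ := by
    by_contra h
    push Not at h
    exact hΘ (Finset.eq_univ_iff_forall.mpr h)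
  have hcard : ∀ μ, IsHighest (restrictedRoots a) b μ → ∑ i ∈ Θᶜ, coeff b μ i ≤ 1 :=
    fun μ hμ => (abs_le.mp (abs_level_le ha hθ hb hcomm hΘ (Or.inl hμ.1))).2
  have h1 : ∀ i, i ∉ Θ ↔ i = e := by
    refine fun i => ⟨fun hi => ?_, fun h => h ▸ he⟩
    by_contra hie
    obtain ⟨μ, hμ⟩ := exists_isHighest ha hb e
    have h := Finset.sum_le_sum_of_subset_of_nonneg (s := {i, e}) (t := Θᶜ)
      (f := fun i => coeff b μ i)
      (by intro j hj; simp only [Finset.mem_insert, Finset.mem_singleton] at hj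
          rcases hj with rfl | rfl <;> simpa)
      (fun j _ _ => by have := hμ.one_le_coeff ha hθ hb j; lia)
    rw [Finset.sum_pair hie] at h
    have h2 := hμ.one_le_coeff ha hθ hb i
    have h3 := hμ.one_le_coeff ha hθ hb e
    have h4 := hcard μ hμ
    lia
  refine ⟨e, h1, fun μ hμ => ?_⟩
  have : Θᶜ = {e} := by
    ext i
    simp [h1]
  have h2 := hcard μ hμ
  rw [this, Finset.sum_singleton] at h2
  exact le_antisymm h2 (hμ.one_le_coeff ha hθ hb e)

end LevelGrading

/-! ### The dimension of the split part -/

section SplitPart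

variable {g : Type*} [LieRing g] [LieAlgebra ℝ g] [Module.Finite ℝ g] [LieAlgebra.IsSimple ℝ g]
  {a : Submodule ℝ g} {θ : g ≃ₗ⁅ℝ⁆ g} {r : ℕ} {b : Fin r → Module.Dual ℝ a}
  (ha : IsMaximalAbelianInP θ a) (hθ : IsCartanInvolution θ)
  (hb : IsSimpleSystem (restrictedRoots a) b)
include ha hθ hb

/-- All restricted roots vanish at such an h, so it is central in a simple algebra. -/
theorem eq_zero_of_forall_simple_eq_zero {h : a} (hh : ∀ i, b i h = 0) : h = 0 := by
  have hc : (h : g) ∈ LieAlgebra.center ℝ g := by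
    rw [LieModule.mem_maxTrivSubmodule]
    intro x
    have hx : x ∈ ⨆ μ, restrictedRootSpace a μ := by
      rw [ha.iSup_restrictedRootSpace hθ]; trivial
    induction hx using Submodule.iSup_induction' with
    | zero => simp
    | add x y _ _ hx hy => rw [add_lie, hx, hy, add_zero]
    | mem μ x hx =>
      by_cases hbot : restrictedRootSpace a μ = ⊥
      · rw [hbot, Submodule.mem_bot] at hx
        rw [hx, zero_lie]
      · have hμ := (hb.isIntegral (mem_or_eq_zero_of_ne_bot hbot)).eq_sum
        rw [← lie_skew, hx h, hμ]
        simp [hh]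
  rw [LieAlgebra.center_eq_bot, LieSubmodule.mem_bot] at hc
  exact Subtype.ext hc

/-- The simple roots are coordinates identifying `a` with ℝ^r: they separate points and are
independent. The split part is then the e-th coordinate axis. -/
theorem finrank_splitPart {Θ : Finset (Fin r)} {e : Fin r} (he : ∀ i, i ∉ Θ ↔ i = e) :
    Module.finrank ℝ (splitPart a b Θ) = 1 := by
  let f : a →ₗ[ℝ] (Fin r → ℝ) := LinearMap.pi b
  have hinj : Function.Injective f := by
    rw [← LinearMap.ker_eq_bot, LinearMap.ker_eq_bot']
    exact fun h hh => eq_zero_of_forall_simple_eq_zero ha hθ hb fun i => congrFun hh i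
  have hle := hb.linearIndependent.fintype_card_le_finrank
  rw [Subspace.dual_finrank_eq, Fintype.card_fin] at hle
  have hge := LinearMap.finrank_le_finrank_of_injective hinj
  rw [Module.finrank_fin_fun] at hge
  have hsurj : Function.Surjective f :=
    (LinearMap.injective_iff_surjective_of_finrank_eq_finrank
      (by rw [Module.finrank_fin_fun]; exact le_antisymm hge hle)).mp hinj
  have hmem : ∀ h : a, h ∈ splitPart a b Θ ↔ ∀ i ∈ Θ, b i h = 0 := by
    intro h
    simp [splitPart, Submodule.mem_iInf]
  obtain ⟨t, ht⟩ := hsurj (Pi.single e 1)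
  have ht' : ∀ i, b i t = if i = e then 1 else 0 := by
    intro i
    have := congrFun ht i
    rwa [Pi.single_apply] at this
  refine finrank_eq_one_iff'.mpr ⟨⟨t, (hmem t).mpr fun i hi => ?_⟩, fun h => ?_, fun w => ?_⟩
  · rw [ht', if_neg fun h => (he i).mpr h hi]
  · have h0 : t = 0 := congrArg Subtype.val h
    have := ht' e
    rw [h0, map_zero, if_pos rfl] at this
    exact zero_ne_one this
  · refine ⟨b e w, Subtype.ext (hinj (funext fun i => ?_))⟩
    change b i (b e w • t) = b i w
    rw [map_smul, ht', smul_eq_mul]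
    by_cases hi : i = e
    · rw [if_pos hi, hi, mul_one]
    · rw [if_neg hi, mul_zero]
      exact ((hmem w).mp w.2 i (by by_contra h; exact hi ((he i).mp h))).symm

end SplitPart

/-! ### Cartan subalgebras containing the maximal abelian subspace -/

section CartanSubalgebra

variable {g : Type*} [LieRing g] [LieAlgebra ℝ g] {a : Submodule ℝ g} {θ : g ≃ₗ⁅ℝ⁆ g}

/-- A Cartan subalgebra containing a maximal abelian subspace of `𝔭` is abelian. -/
theorem lie_eq_zero_of_mem_cartanSubalgebra (ha : IsMaximalAbelianInP θ a)
    (hθ : IsCartanInvolution θ) {H : LieSubalgebra ℝ g} (hH : H.IsCartanSubalgebra)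
    (haH : a ≤ H.toSubmodule) {x y : g} (hx : x ∈ H) (hy : y ∈ H) : ⁅x, y⁆ = 0 := by
  have := hH.nilpotent
  -- Nilpotency of H makes ad z nilpotent on H, and an eigenvector of θ has no proper generalised
  -- kernel.
  have hnil : ∀ {z : g} {ε : ℝ}, z ∈ H → θ z = ε • z → ∀ y ∈ H, ⁅z, y⁆ = 0 := by
    intro z ε hz hzθ y hy
    obtain ⟨n, hn⟩ := LieModule.isNilpotent_toEnd_of_isNilpotent ℝ H H ⟨z, hz⟩
    refine hθ.lie_eq_zero_of_ad_pow hzθ n ?_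
    have h1 : ∀ (n : ℕ) (w : H), ((LieAlgebra.ad ℝ g z) ^ n) (w : g) =
        (((LieModule.toEnd ℝ H H ⟨z, hz⟩) ^ n) w : H) := by
      intro n
      induction n with
      | zero => intro w; simp
      | succ n ih =>
        intro w
        rw [pow_succ, pow_succ, Module.End.mul_apply, Module.End.mul_apply, ← ih]
        rfl
    rw [h1 n ⟨y, hy⟩, hn]
    rfl
  have haz : ∀ h ∈ a, ∀ y ∈ H, ⁅h, y⁆ = 0 := fun h hh =>
    hnil (ε := -1) (haH hh) (by rw [ha.map_eq_neg hh]; simp)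
  have hθx : ∀ h : a, ⁅(h : g), θ x⁆ = 0 := fun h => by
    have := congrArg θ (haz h h.2 x hx)
    rw [LieEquiv.map_lie, ha.map_eq_neg h.2, neg_lie, map_zero, neg_eq_zero] at this
    exact this
  have hp : x - θ x ∈ a := by
    apply ha.mem_of_map_eq_neg
    · rw [map_sub, hθ.involutive, neg_sub]
    · intro h
      rw [lie_sub, haz h h.2 x hx, hθx h]
      simp
  -- Stability of H under θ is not assumed: x - θx lies in `a`, hence in H, and so does x + θx = 2x
  -- - (x - θx).
  have hk : x + θ x ∈ H := by
    have : x + θ x = (2 : ℝ) • x - (x - θ x) := by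
      rw [two_smul]; abel
    rw [this]
    exact H.sub_mem (H.smul_mem _ hx) (haH hp)
  have h1 := haz _ hp y hy
  have h2 := hnil (ε := 1) hk (by rw [map_add, hθ.involutive, one_smul, add_comm]) y hy
  have h3 : (2 : ℝ) • ⁅x, y⁆ = 0 := by
    rw [sub_lie] at h1
    rw [add_lie] at h2
    have h4 : ⁅x, y⁆ + ⁅x, y⁆ = (⁅x, y⁆ - ⁅θ x, y⁆) + (⁅x, y⁆ + ⁅θ x, y⁆) := by abel
    rw [two_smul, h4, h1, h2, add_zero]
  exact (smul_eq_zero.mp h3).resolve_left two_ne_zero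

end CartanSubalgebra

/-! ### Weights of an abelian subalgebra on the complexification -/

section ComplexRootSpaces

variable {g : Type*} [LieRing g] [LieAlgebra ℝ g] {H : LieSubalgebra ℝ g}

/-- The joint generalised eigenspace of `H` on the complexification. -/
noncomputable def genRootSpaceC (H : LieSubalgebra ℝ g) (χ : H → ℂ) :
    Submodule ℂ (Complexification g) :=
  ⨅ h : H, (LieAlgebra.ad ℂ (Complexification g) ((1 : ℂ) ⊗ₜ[ℝ] (h : g))).maxGenEigenspace (χ h)

theorem lie_mem_genRootSpaceC {α β : H → ℂ} {x y : Complexification g}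
    (hx : x ∈ genRootSpaceC H α) (hy : y ∈ genRootSpaceC H β) :
    ⁅x, y⁆ ∈ genRootSpaceC H (α + β) := by
  rw [genRootSpaceC, Submodule.mem_iInf] at hx hy ⊢
  exact fun h => LieModule.lie_mem_maxGenEigenspace_toEnd (hx h) (hy h)

theorem rootSpaceC_le_genRootSpaceC (α : ComplexFunctional H) :
    rootSpaceC H α ≤ genRootSpaceC H α := by
  intro x hx
  rw [genRootSpaceC, Submodule.mem_iInf]
  intro h
  rw [Module.End.mem_maxGenEigenspace]
  refine ⟨1, ?_⟩
  have := hx h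
  simp [this]

/-- A joint eigenvector has a linear weight. -/
theorem exists_complexFunctional {v : Complexification g} (hv0 : v ≠ 0)
    (hv : ∀ h : H, ∃ c : ℂ, ⁅((1 : ℂ) ⊗ₜ[ℝ] (h : g) : Complexification g), v⁆ = c • v) :
    ∃ α : ComplexFunctional H, v ∈ rootSpaceC H α := by
  choose χ hχ using hv
  have hinj : ∀ {c d : ℂ}, c • v = d • v → c = d := fun h => smul_left_injective ℂ hv0 h
  refine ⟨{ toFun := χ, map_add' := fun h h' => hinj ?_, map_smul' := fun c h => hinj ?_ }, hχ⟩
  · have : ((1 : ℂ) ⊗ₜ[ℝ] ((h + h' : H) : g) : Complexification g) =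
        (1 : ℂ) ⊗ₜ[ℝ] (h : g) + (1 : ℂ) ⊗ₜ[ℝ] (h' : g) := TensorProduct.tmul_add _ _ _
    rw [← hχ, this, add_lie, hχ, hχ, add_smul]
  · have : ((1 : ℂ) ⊗ₜ[ℝ] ((c • h : H) : g) : Complexification g) =
        (c : ℂ) • ((1 : ℂ) ⊗ₜ[ℝ] (h : g)) := by
      rw [TensorProduct.smul_tmul', smul_eq_mul, mul_one]
      change (1 : ℂ) ⊗ₜ[ℝ] (c • (h : g)) = (c : ℂ) ⊗ₜ[ℝ] (h : g)
      rw [← TensorProduct.smul_tmul]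
      congr 1
      simp
    rw [← hχ, this, smul_lie, hχ, smul_smul]
    simp

variable (hcomm : ∀ x ∈ H, ∀ y ∈ H, ⁅x, y⁆ = 0)
include hcomm

theorem commute_ad_tmul (h h' : H) :
    Commute (LieAlgebra.ad ℂ (Complexification g) ((1 : ℂ) ⊗ₜ[ℝ] (h : g)))
      (LieAlgebra.ad ℂ (Complexification g) ((1 : ℂ) ⊗ₜ[ℝ] (h' : g))) := by
  refine LinearMap.ext fun x => ?_
  have h0 : (⁅(1 : ℂ) ⊗ₜ[ℝ] (h : g), (1 : ℂ) ⊗ₜ[ℝ] (h' : g)⁆ : Complexification g) = 0 := by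
    rw [LieAlgebra.ExtendScalars.bracket_tmul, hcomm h h.2 h' h'.2, TensorProduct.tmul_zero]
  simp only [Module.End.mul_apply, LieAlgebra.ad_apply]
  rw [leibniz_lie, h0, zero_lie, zero_add]

variable [Module.Finite ℝ g]

theorem iSup_genRootSpaceC : ⨆ χ, genRootSpaceC H χ = ⊤ :=
  Module.End.iSup_iInf_maxGenEigenspace_eq_top_of_iSup_maxGenEigenspace_eq_top_of_commute
    (fun h : H => LieAlgebra.ad ℂ (Complexification g) ((1 : ℂ) ⊗ₜ[ℝ] (h : g)))
    (fun h h' _ => commute_ad_tmul hcomm h h')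
    fun _ => Module.End.iSup_maxGenEigenspace_eq_top _

/-- A nonzero subspace of the complexification invariant under `H` contains a weight vector. -/
theorem exists_mem_rootSpaceC {p : Submodule ℂ (Complexification g)} (hp : p ≠ ⊥)
    (hinv : ∀ h : H, ∀ v ∈ p, ⁅((1 : ℂ) ⊗ₜ[ℝ] (h : g) : Complexification g), v⁆ ∈ p) :
    ∃ α : ComplexFunctional H, ∃ v ∈ p, v ≠ 0 ∧ v ∈ rootSpaceC H α := by
  obtain ⟨v, hv, hv0, hv'⟩ := exists_joint_eigenvector
    (F := fun h : H => LieAlgebra.ad ℂ (Complexification g) ((1 : ℂ) ⊗ₜ[ℝ] (h : g)))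
    (commute_ad_tmul hcomm) _ p rfl hp hinv
  obtain ⟨α, hα⟩ := exists_complexFunctional hv0 hv'
  exact ⟨α, v, hv, hv0, hα⟩

/-- The joint generalised eigenvalues of `H` are zero and the roots. -/
theorem exists_of_genRootSpaceC_ne_bot {χ : H → ℂ} (hχ : genRootSpaceC H χ ≠ ⊥) :
    ∃ α : ComplexFunctional H, ⇑α = χ ∧ (α ∈ rootsC H ∨ α = 0) := by
  -- The generalised eigenspace is H-invariant, so it contains a true weight vector. Its weight must
  -- be χ, as generalised eigenspaces for distinct eigenvalues are disjoint.
  obtain ⟨α, v, hv, hv0, hα⟩ := exists_mem_rootSpaceC hcomm hχ fun h v hv => by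
    rw [genRootSpaceC, Submodule.mem_iInf] at hv ⊢
    exact fun h' => Module.End.mapsTo_maxGenEigenspace_of_comm (commute_ad_tmul hcomm h' h) _ (hv h')
  refine ⟨α, funext fun h => ?_, or_iff_not_imp_right.mpr fun h0 =>
    ⟨h0, (Submodule.ne_bot_iff _).mpr ⟨v, hα, hv0⟩⟩⟩
  by_contra hne
  rw [genRootSpaceC, Submodule.mem_iInf] at hv
  have h1 := rootSpaceC_le_genRootSpaceC α hα
  rw [genRootSpaceC, Submodule.mem_iInf] at h1
  exact hv0 ((Submodule.disjoint_def.mp (Module.End.disjoint_genEigenspace _ hne ⊤ ⊤)) v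
    (h1 h) (hv h))

end ComplexRootSpaces

/-! ### Roots versus restricted roots -/

section Restriction

variable {g : Type*} [LieRing g] [LieAlgebra ℝ g]

/-- The contraction of the complexification with a real-linear form on `ℂ`. -/
noncomputable def contract (φ : ℂ →ₗ[ℝ] ℝ) : Complexification g →ₗ[ℝ] g :=
  TensorProduct.lift ((LinearMap.lsmul ℝ g).comp φ)

@[simp]
theorem contract_tmul (φ : ℂ →ₗ[ℝ] ℝ) (c : ℂ) (x : g) : contract φ (c ⊗ₜ[ℝ] x) = φ c • x := rfl

theorem contract_lie (φ : ℂ →ₗ[ℝ] ℝ) (x : g) (v : Complexification g) :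
    contract φ ⁅((1 : ℂ) ⊗ₜ[ℝ] x : Complexification g), v⁆ = ⁅x, contract φ v⁆ := by
  induction v using TensorProduct.induction_on with
  | zero => simp
  | tmul c y => simp [LieAlgebra.ExtendScalars.bracket_tmul]
  | add v w hv hw => rw [lie_add, map_add, map_add, lie_add, hv, hw]

theorem contract_smul (φ : ℂ →ₗ[ℝ] ℝ) (c : ℝ) (v : Complexification g) :
    contract φ ((c : ℂ) • v) = c • contract φ v := by
  induction v using TensorProduct.induction_on with
  | zero => simp
  | tmul d y =>
    have : (c : ℂ) * d = c • d := by simp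
    rw [TensorProduct.smul_tmul', smul_eq_mul, this, contract_tmul, map_smul, contract_tmul,
      smul_eq_mul, mul_smul]
  | add v w hv hw => rw [smul_add, map_add, map_add, smul_add, hv, hw]

theorem eq_tmul_add_tmul (v : Complexification g) :
    v = (1 : ℂ) ⊗ₜ[ℝ] contract Complex.reLm v + Complex.I ⊗ₜ[ℝ] contract Complex.imLm v := by
  induction v using TensorProduct.induction_on with
  | zero => simp
  | tmul c y =>
    rw [contract_tmul, contract_tmul, ← TensorProduct.smul_tmul, ← TensorProduct.smul_tmul,
      ← TensorProduct.add_tmul]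
    congr 1
    apply Complex.ext <;> simp
  | add v w hv hw =>
    rw [map_add, map_add, TensorProduct.tmul_add, TensorProduct.tmul_add]
    conv_lhs => rw [hv, hw]
    abel

variable {H : LieSubalgebra ℝ g} {a : Submodule ℝ g} (haH : a ≤ H.toSubmodule)
include haH

theorem RestrictsTo.unique {α : ComplexFunctional H} {μ ν : Module.Dual ℝ a}
    (hμ : RestrictsTo α μ) (hν : RestrictsTo α ν) : μ = ν := by
  ext x
  exact_mod_cast (hμ x (haH x.2) x.2).symm.trans (hν x (haH x.2) x.2)

/-- Since α is real on `a`, the real and imaginary parts of a root vector lie in the real space of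
weight μ, and they are not both zero. -/
theorem RestrictsTo.mem_or_eq_zero {α : ComplexFunctional H} {μ : Module.Dual ℝ a}
    (hμ : RestrictsTo α μ) (hα : α ∈ rootsC H ∨ α = 0) : μ ∈ restrictedRoots a ∨ μ = 0 := by
  rcases hα with ⟨-, hα⟩ | rfl
  · obtain ⟨v, hv, hv0⟩ := Submodule.exists_mem_ne_zero_of_ne_bot hα
    have h1 : ∀ φ : ℂ →ₗ[ℝ] ℝ, contract φ v ∈ restrictedRootSpace a μ := by
      intro φ h
      have h2 := congrArg (contract φ) (hv ⟨h, haH h.2⟩)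
      rwa [contract_lie, hμ h (haH h.2) h.2, contract_smul] at h2
    refine mem_or_eq_zero_of_ne_bot fun hbot => hv0 ?_
    simp only [hbot, Submodule.mem_bot] at h1
    rw [eq_tmul_add_tmul v, h1, h1, TensorProduct.tmul_zero, TensorProduct.tmul_zero, add_zero]
  · right
    ext x
    simpa using (hμ x (haH x.2) x.2).symm

omit haH in
theorem RestrictsTo.sum_smul {s : ℕ} {β : Fin s → ComplexFunctional H}
    {m : Fin s → Module.Dual ℝ a} (hm : ∀ j, RestrictsTo (β j) (m j)) (c : Fin s → ℤ) :
    RestrictsTo (∑ j, c j • β j) (∑ j, c j • m j) := by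
  intro x hH hx
  simp [LinearMap.sum_apply, hm _ x hH hx]

/-- Every restricted root is the restriction of a root. -/
theorem exists_rootsC_restrictsTo [Module.Finite ℝ g] (hcomm : ∀ x ∈ H, ∀ y ∈ H, ⁅x, y⁆ = 0)
    {μ : Module.Dual ℝ a} (hμ : μ ∈ restrictedRoots a) : ∃ α ∈ rootsC H, RestrictsTo α μ := by
  obtain ⟨x, hx, hx0⟩ := Submodule.exists_mem_ne_zero_of_ne_bot hμ.2
  -- The μ-eigenspace of `a` on the complexification is H-invariant because H is abelian and
  -- contains `a`; any weight vector of H in it has a weight restricting to μ.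
  let p : Submodule ℂ (Complexification g) :=
    ⨅ h : a, (LieAlgebra.ad ℂ (Complexification g) ((1 : ℂ) ⊗ₜ[ℝ] (h : g))).eigenspace
      ((μ h : ℝ) : ℂ)
  have hp : ∀ {v}, v ∈ p ↔ ∀ h : a,
      ⁅((1 : ℂ) ⊗ₜ[ℝ] (h : g) : Complexification g), v⁆ = ((μ h : ℝ) : ℂ) • v := by
    intro v
    simp only [p, Submodule.mem_iInf, Module.End.mem_eigenspace_iff, LieAlgebra.ad_apply]
  have hxp : (1 : ℂ) ⊗ₜ[ℝ] x ∈ p := by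
    rw [hp]
    intro h
    rw [LieAlgebra.ExtendScalars.bracket_tmul, hx h, ← TensorProduct.smul_tmul,
      TensorProduct.smul_tmul']
    congr 1
    simp
  have hx1 : ((1 : ℂ) ⊗ₜ[ℝ] x : Complexification g) ≠ 0 := by
    intro h
    have := congrArg (contract Complex.reLm) h
    rw [contract_tmul, map_zero] at this
    exact hx0 (by simpa using this)
  obtain ⟨α, v, hv, hv0, hα⟩ := exists_mem_rootSpaceC hcomm (p := p)
    ((Submodule.ne_bot_iff _).mpr ⟨_, hxp, hx1⟩) (by
      intro h v hv
      rw [hp] at hv ⊢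
      intro t
      have h0 : (⁅(1 : ℂ) ⊗ₜ[ℝ] (t : g), (1 : ℂ) ⊗ₜ[ℝ] (h : g)⁆ : Complexification g) = 0 := by
        rw [LieAlgebra.ExtendScalars.bracket_tmul, hcomm t (haH t.2) h h.2,
          TensorProduct.tmul_zero]
      rw [leibniz_lie, h0, zero_lie, zero_add, hv t, lie_smul])
  have hr : RestrictsTo α μ := fun y hH hy =>
    smul_left_injective ℂ hv0 ((hα ⟨y, hH⟩).symm.trans (hp.mp hv ⟨y, hy⟩))
  refine ⟨α, ⟨fun h0 => hμ.1 ?_, (Submodule.ne_bot_iff _).mpr ⟨v, hα, hv0⟩⟩, hr⟩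
  ext y
  have := hr y (haH y.2) y.2
  rw [h0] at this
  simpa using this.symm

end Restriction

/-! ### Linking two simple roots through a common root -/

section ComplexSimpleRoots

variable {g : Type*} [LieRing g] [LieAlgebra ℝ g] [Module.Finite ℝ g] {H : LieSubalgebra ℝ g}
  (hcomm : ∀ x ∈ H, ∀ y ∈ H, ⁅x, y⁆ = 0)
  {s : ℕ} {β : Fin s → ComplexFunctional H} (hβ : IsSimpleSystem (rootsC H) β)
include hcomm hβ

/-- If the complexification is simple, then no two simple roots exclude each other from
the support of roots. -/
theorem exists_one_lt_coeff [LieAlgebra.IsSimple ℂ (Complexification g)] {i j : Fin s}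
    (hij : i ≠ j) :
    ∃ α, (α ∈ rootsC H ∨ α = 0) ∧ 1 < |coeff β α i| + |coeff β α j| := by
  by_contra hall
  push Not at hall
  have hli := hβ.linearIndependent
  have hint : ∀ {α}, α ∈ rootsC H ∨ α = 0 → IsIntegral β α := hβ.isIntegral
  have hsupp : ∀ {α : ComplexFunctional H}, genRootSpaceC H α ≠ ⊥ → α ∈ rootsC H ∨ α = 0 := by
    intro α hα
    obtain ⟨α', h, h'⟩ := exists_of_genRootSpaceC_ne_bot hcomm hα
    rwa [DFunLike.coe_injective h] at h'
  -- P collects the weights involving `β i`; weights not involving it normalise P. If the claim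
  -- failed, a root vector for `β j` would centralise P, against simplicity.
  let P : Submodule ℂ (Complexification g) :=
    ⨆ α ∈ {α : ComplexFunctional H | (α ∈ rootsC H ∨ α = 0) ∧ coeff β α i ≠ 0}, genRootSpaceC H α
  have hle : ∀ {α : ComplexFunctional H}, (α ∈ rootsC H ∨ α = 0) → coeff β α i ≠ 0 →
      genRootSpaceC H α ≤ P := fun {α} h h' => le_iSup₂_of_le α ⟨h, h'⟩ le_rfl
  obtain ⟨x, hx, hx0⟩ := Submodule.exists_mem_ne_zero_of_ne_bot (hβ.mem j).2
  refine hx0 (eq_zero_of_forall_lie_eq_zero (K := ℂ) (P := P) (fun hP => ?_) ?_ fun p hp => ?_)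
  · refine (hβ.mem i).2 (le_bot_iff.mp (hP ▸ (rootSpaceC_le_genRootSpaceC (β i)).trans
      (hle (Or.inl (hβ.mem i)) ?_)))
    rw [coeff_self hli, if_pos rfl]
    exact one_ne_zero
  · rw [eq_top_iff, ← iSup_genRootSpaceC hcomm]
    refine iSup_le fun χ => ?_
    by_cases hχ : genRootSpaceC H χ = ⊥
    · rw [hχ]; exact bot_le
    obtain ⟨α, rfl, hα⟩ := exists_of_genRootSpaceC_ne_bot hcomm hχ
    intro y hy
    apply Submodule.subset_span
    by_cases hc : coeff β α i = 0
    · refine Or.inr fun p hp => ?_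
      simp only [P] at hp
      rw [iSup_subtype'] at hp
      induction hp using Submodule.iSup_induction' with
      | zero => rw [lie_zero]; exact Submodule.zero_mem _
      | add p q _ _ h h' => rw [lie_add]; exact Submodule.add_mem _ h h'
      | mem γ p hp =>
        have h1 : ⁅y, p⁆ ∈ genRootSpaceC H ⇑(α + γ.1) := lie_mem_genRootSpaceC hy hp
        by_cases h0 : genRootSpaceC H ⇑(α + γ.1) = ⊥
        · rw [h0, Submodule.mem_bot] at h1
          rw [h1]
          exact Submodule.zero_mem _
        · refine hle (hsupp h0) ?_ h1
          rw [coeff_add hli (hint hα) (hint γ.2.1), hc, zero_add]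
          exact γ.2.2
    · exact Or.inl (hle hα hc hy)
  · simp only [P] at hp
    rw [iSup_subtype'] at hp
    induction hp using Submodule.iSup_induction' with
    | zero => rw [lie_zero]
    | add p q _ _ h h' => rw [lie_add, h, h', add_zero]
    | mem γ p hp =>
      have h1 : ⁅x, p⁆ ∈ genRootSpaceC H ⇑(β j + γ.1) :=
        lie_mem_genRootSpaceC (rootSpaceC_le_genRootSpaceC _ hx) hp
      by_contra h0
      -- As γ involves `β i`, the bound for γ forces its coefficient at j to be 0; then `β j` + γ
      -- violates the bound.
      have h2 := hall _ (hsupp ((Submodule.ne_bot_iff _).mpr ⟨_, h1, h0⟩))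
      have h3 := hall _ γ.2.1
      have h4 := γ.2.2
      simp only [coeff_add hli (isIntegral_self j) (hint γ.2.1), coeff_self hli, if_neg hij,
        if_true] at h2
      grind

end ComplexSimpleRoots

/-! ### The simple root of level one -/

section LevelOne

variable {g : Type*} [LieRing g] [LieAlgebra ℝ g] [Module.Finite ℝ g] {a : Submodule ℝ g}
  {r : ℕ} {b : Fin r → Module.Dual ℝ a} {Θ : Finset (Fin r)}

/-- If the level takes no values other than `-1, 0, 1` and `e` is the only simple restricted root
outside `Θ`, then exactly one of the simple roots has level one, and it restricts to `b e`. -/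
theorem exists_unique_hasLevel_one [LieAlgebra.IsSimple ℂ (Complexification g)]
    (hb : IsSimpleSystem (restrictedRoots a) b)
    (hlevel : ∀ μ, μ ∈ restrictedRoots a ∨ μ = 0 → |level b Θ μ| ≤ 1)
    {e : Fin r} (he : ∀ i, i ∉ Θ ↔ i = e) {H : LieSubalgebra ℝ g}
    (hcomm : ∀ x ∈ H, ∀ y ∈ H, ⁅x, y⁆ = 0) (haH : a ≤ H.toSubmodule)
    {s : ℕ} {β : Fin s → ComplexFunctional H} (hβ : IsSimpleSystem (rootsC H) β)
    (hcompat : IsCompatible b β) :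
    ∃ j : Fin s, (∀ j', HasLevel b Θ (β j') 1 ↔ j' = j) ∧ RestrictsTo (β j) (b e) := by
  have hli := hb.linearIndependent
  choose m hm hmn using hcompat
  have hmi : ∀ j, IsIntegral b (m j) := fun j => (hmn j).isIntegral
  have hlm : ∀ j, 0 ≤ level b Θ (m j) := fun j => level_nonneg Θ hli (hmn j)
  have hres : ∀ {α}, α ∈ rootsC H ∨ α = 0 → RestrictsTo α (∑ j, coeff β α j • m j) := by
    intro α hα
    have := RestrictsTo.sum_smul hm (coeff β α)
    rwa [← (hβ.isIntegral hα).eq_sum] at this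
  have hΘ : ∀ v, level b Θ v = coeff b v e := by
    have : Θᶜ = {e} := by
      ext i
      simp [he]
    intro v
    rw [level, this, Finset.sum_singleton]
  obtain ⟨α, hα, hαe⟩ := exists_rootsC_restrictsTo haH hcomm (hb.mem e)
  have hsum := RestrictsTo.unique haH hαe (hres (Or.inl hα))
  have hlev := level_sum_smul Θ hli hmi (coeff β α)
  rw [← hsum, level_self Θ hli, if_neg ((he e).mpr rfl)] at hlev
  have hα0 : ∀ j, 0 ≤ coeff β α j := by
    refine (hβ.coeff_nonneg_or (Or.inl hα)).resolve_right fun h => ?_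
    have := Finset.sum_nonpos fun j (_ : j ∈ Finset.univ) =>
      mul_nonpos_of_nonpos_of_nonneg (h j) (hlm j)
    lia
  obtain ⟨j, -, hj⟩ : ∃ j ∈ Finset.univ, 0 < coeff β α j * level b Θ (m j) := by
    by_contra h
    push Not at h
    have := Finset.sum_nonpos h
    lia
  have hcj : 1 ≤ coeff β α j := by
    have := hα0 j
    rcases this.eq_or_lt with h | h
    · rw [← h, zero_mul] at hj
      exact absurd hj (lt_irrefl _)
    · exact h
  have hlj : 1 ≤ level b Θ (m j) := by
    rcases (hlm j).eq_or_lt with h | h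
    · rw [← h, mul_zero] at hj
      exact absurd hj (lt_irrefl _)
    · exact h
  have hnn : ∀ j i, 0 ≤ coeff b (m j) i := fun j => ((isNonneg_iff hli).mp (hmn j)).2
  -- `b e` is a nonnegative combination of the `m k` in which `m j` has coefficient at least 1. So
  -- `m j` is at most `b e`, and having positive level it equals `b e`.
  have hbound : ∀ i, coeff b (m j) i ≤ coeff b (b e) i := by
    intro i
    have h1 := coeff_sum_smul hli hmi (coeff β α) i
    rw [← hsum] at h1
    rw [h1]
    refine le_trans ?_ (Finset.single_le_sum (fun k _ => mul_nonneg (hα0 k) (hnn k i))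
      (Finset.mem_univ j))
    exact le_mul_of_one_le_left (hnn j i) hcj
  have hmj : m j = b e := by
    refine eq_of_coeff_eq (hmi j) (isIntegral_self e) fun i => le_antisymm (hbound i) ?_
    rw [coeff_self hli]
    split_ifs with hi
    · rw [hi, ← hΘ]
      exact hlj
    · exact hnn j i
  refine ⟨j, fun j' => ⟨fun h => ?_, fun h => ?_⟩, hmj ▸ hm j⟩
  · by_contra hne
    obtain ⟨μ, hμ, hμ1⟩ := h
    rw [RestrictsTo.unique haH hμ (hm j')] at hμ1
    -- With both simple roots of level at least 1, the coefficients of γ at j and j' alone give it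
    -- level at least 2 in absolute value; those of one sign cannot cancel.
    obtain ⟨γ, hγ, hγ1⟩ := exists_one_lt_coeff hcomm hβ hne
    have h1 := hlevel _ ((hres hγ).mem_or_eq_zero haH hγ)
    rw [level_sum_smul Θ hli hmi] at h1
    have key : ∀ c : Fin s → ℤ, (∀ k, 0 ≤ c k) →
        c j' + c j ≤ ∑ k, c k * level b Θ (m k) := by
      intro c hc
      have h2 := Finset.sum_le_sum_of_subset_of_nonneg (Finset.subset_univ {j', j})
        (f := fun k => c k * level b Θ (m k)) fun k _ _ => mul_nonneg (hc k) (hlm k)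
      rw [Finset.sum_pair hne, hμ1, mul_one] at h2
      have := le_mul_of_one_le_right (hc j) hlj
      lia
    rw [abs_le] at h1
    rcases hβ.coeff_nonneg_or hγ with hs | hs
    · have := key _ hs
      rw [abs_of_nonneg (hs _), abs_of_nonneg (hs _)] at hγ1
      lia
    · have := key (fun k => -coeff β γ k) fun k => neg_nonneg.mpr (hs k)
      simp only [neg_mul, Finset.sum_neg_distrib] at this
      rw [abs_of_nonpos (hs _), abs_of_nonpos (hs _)] at hγ1
      lia
  · subst h
    exact ⟨m j', hm j', by rw [hmj, level_self Θ hli, if_neg ((he e).mpr rfl)]⟩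

end LevelOne

end RestrictedRoots

open RestrictedRoots in
theorem mainTheorem4 {g : Type*} [LieRing g] [LieAlgebra ℝ g] [Module.Finite ℝ g]
    [LieAlgebra.IsSimple ℝ g]
    (θ : g ≃ₗ⁅ℝ⁆ g) (hθ : RestrictedRoots.IsCartanInvolution θ)
    (a : Submodule ℝ g) (ha : RestrictedRoots.IsMaximalAbelianInP θ a)
    {r : ℕ} (b : Fin r → Module.Dual ℝ a)
    (hb : RestrictedRoots.IsSimpleSystem (RestrictedRoots.restrictedRoots a) b)
    (Θ : Finset (Fin r)) (hΘ : Θ ≠ Finset.univ)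
    (hcomm : ∀ x ∈ RestrictedRoots.nilPos a b Θ, ∀ y ∈ RestrictedRoots.nilNeg a b Θ,
      ⁅x, y⁆ ∈ RestrictedRoots.levi a b Θ) :
    -- the level gradation is a 3-grading whose outer terms are `n_Θ^±`
    (RestrictedRoots.IsOddGrading 1 (RestrictedRoots.levelSpace a b Θ) ∧
      RestrictedRoots.nilPos a b Θ = RestrictedRoots.levelSpace a b Θ 1 ∧
      RestrictedRoots.nilNeg a b Θ = RestrictedRoots.levelSpace a b Θ (-1)) ∧
    -- `n_Θ^+` and `n_Θ^-` are abelian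
    ((∀ x ∈ RestrictedRoots.nilPos a b Θ, ∀ y ∈ RestrictedRoots.nilPos a b Θ, ⁅x, y⁆ = 0) ∧
      (∀ x ∈ RestrictedRoots.nilNeg a b Θ, ∀ y ∈ RestrictedRoots.nilNeg a b Θ, ⁅x, y⁆ = 0)) ∧
    -- exactly one simple restricted root lies outside `Θ`, and its Coxeter label is one
    (∃ e : Fin r, (∀ i, i ∉ Θ ↔ i = e) ∧
      (∃! μ, RestrictedRoots.IsHighest (RestrictedRoots.restrictedRoots a) b μ) ∧
      (∀ μ, RestrictedRoots.IsHighest (RestrictedRoots.restrictedRoots a) b μ →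
        RestrictedRoots.coeff b μ e = 1) ∧
      -- if the complexification is simple, exactly one simple root has level one,
      -- and it restricts to the simple restricted root outside `Θ`
      (LieAlgebra.IsSimple ℂ (RestrictedRoots.Complexification g) →
        ∀ H : LieSubalgebra ℝ g, H.IsCartanSubalgebra → a ≤ H.toSubmodule →
        ∀ (s : ℕ) (β : Fin s → RestrictedRoots.ComplexFunctional H),
          RestrictedRoots.IsSimpleSystem (RestrictedRoots.rootsC H) β →
          RestrictedRoots.IsCompatible b β →
          ∃ j : Fin s, (∀ j', RestrictedRoots.HasLevel b Θ (β j') 1 ↔ j' = j) ∧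
            RestrictedRoots.RestrictsTo (β j) (b e))) ∧
    -- the split part `a_Θ` is one-dimensional
    Module.finrank ℝ (RestrictedRoots.splitPart a b Θ) = 1 := by
  have hpos := nilPos_eq ha hθ hb hcomm hΘ
  have hneg := nilNeg_eq ha hθ hb hcomm hΘ
  obtain ⟨e, he, hlabel⟩ := exists_unique_notMem ha hθ hb hcomm hΘ
  refine ⟨⟨isOddGrading_levelSpace ha hθ hb hcomm hΘ, hpos, hneg⟩, ⟨?_, ?_⟩,
    ⟨e, he, ?_, hlabel, ?_⟩, finrank_splitPart ha hθ hb he⟩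
  · rw [hpos]
    exact fun x hx y hy => lie_eq_zero_of_add_ne_zero ha hθ hb hcomm (by lia) (by lia) (by lia) hx hy
  · rw [hneg]
    exact fun x hx y hy => lie_eq_zero_of_add_ne_zero ha hθ hb hcomm (by lia) (by lia) (by lia) hx hy
  · obtain ⟨μ, hμ⟩ := exists_isHighest ha hb e
    exact ⟨μ, hμ, fun ν hν => hν.unique ha hθ hb hμ⟩
  · intro hC H hH haH s β hβ hcompat
    exact exists_unique_hasLevel_one hb (fun μ => abs_level_le ha hθ hb hcomm hΘ) he
      (fun x hx y hy => lie_eq_zero_of_mem_cartanSubalgebra ha hθ hH haH hx hy) haH hβ hcompat
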